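/- **Definitions.** A nondeterministic Büchi automaton (NBW) is $A=(\Sigma,Q,Q^{in},\rho,F)$ with $\Sigma$, $Q$ finite, $Q^{in},F\subseteq Q$ and $\rho:Q\times\Sigma\to 2^Q$; it accepts $w=\sigma_0\sigma_1\cdots\in\Sigma^\omega$ iff some sequence $p_0p_1\cdots$ with $p_0\in Q^{in}$ and $p_{i+1}\in\rho(p_i,\sigma_i)$ for all $i$ has $p_i\in F$ for infinitely many $i$. Write $\rho(R,\sigma)=\bigcup_{q\in R}\rho(q,\sigma)$, $n=|Q|$, $m=2|Q\setminus F|$. An NBW is *deterministic in the limit* if every state $s$ reachable from an accepting state has at most one $\sigma$-successor for each letter $\sigma$. *Preordered subsets.* A preordered subset is a pair $\mathcal S=(S,\preceq)$ with $S\subseteq Q$ and $\preceq$ a total preorder on $S$; $\prec$ and $\approx$ are its strict part and its equivalence. Let $\rho_{\mathcal S}(q,\sigma)$ be the set of $r\in\rho(q,\sigma)$ such that $q'\preceq q$ whenever $q'\in S$ and $r\in\rho(q',\sigma)$. The $\sigma$-successor of $\mathcal S$ is $(\rho(S,\sigma),\preceq')$ such that for $q,r\in S$, $q'\in\rho_{\mathcal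 S}(q,\sigma)$, $r'\in\rho_{\mathcal S}(r,\sigma)$: if $q\prec r$ then $q'\prec' r'$; if $q\approx r$ and $q',r'$ are both in $F$ or both not in $F$ then $q'\approx' r'$; if $q\approx r$, $q'\notin F$ and $r'\in F$ then $q'\prec' r'$. *Tight level rankings.* A level ranking is $f:Q\to\{0,\dots,m,\bot\}$ with $f(q)$ even or $\bot$ for $q\in F$; it is tight if every odd number up to its maximal rank is a rank. Let $\mathcal R_T$ be the set of tight level rankings, and let $even(f)$, $odd(f)$ be the sets of states of even and of odd rank. For a preordered subset, $\mathrm{torank}(S,\preceq)(q)$ is $\bot$ if $q\notin S$, $2\beta(q)$ if $q\in S\cap F$ and $2\beta(q)+1$ if $q\in S\setminus F$, where $\beta(q)$ is the number of $\approx$-classes $[v]$ with $v\in S\setminus F$ and $q\prec v$. For a level ranking $f$, $\mathrm{tighten}(f)(q)$ is $\bot$ if $f(q)=\bot$, $2\gamma(q)$ if $f(q)$ is even and $2\gamma(q)+1$ if $f(q)$ is odd, where $\gamma(q)$ is the number of odd ranks of $f$ that are smaller than $f(q)$. The $\sigma$-successor of $f$ is $\mathrm{tighten}(g)$, where $g(q')$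 is $\bot$ if no $q$ with $f(q)\ne\bot$ has $q'\in\rho(q,\sigma)$, and otherwise is the least $f(q)\neq\bot$ among these $q$, rounded down to an even number if $q'\in F$. *The automaton $A_L$.* Its states are the preordered subsets (first stage) and the pairs in $\mathcal R_T\times 2^Q$ (second stage). Its one initial state is $Q^{in}$ with the preorder $q\preceq r\iff q\notin F\text{ or }r\in F$. A first-stage state $\mathcal S$ has the two $\sigma$-successors $\mathcal S'$ and $(\mathrm{torank}(\mathcal S'),\emptyset)$, where $\mathcal S'$ is the $\sigma$-successor of $\mathcal S$. A second-stage state $(f,O)$ has the one $\sigma$-successor $(f',O')$, where $f'$ is the $\sigma$-successor of $f$, and $O'=\rho(O,\sigma)\setminus odd(f')$ if $O\ne\emptyset$, $O'=even(f')$ if $O=\emptyset$. The accepting states are the pairs $(f,\emptyset)$. *$F$-finite levels.* The run dag of $A$ on $w$ has as vertices the pairs $(q,i)$ such that some finite run of $A$ on $w$ is in $q$ at position $i$, and an edge from $(q,i)$ to $(r,i+1)$ iff $r\in\rho(q,\sigma_i)$. The profile of a path is the $0/1$-sequence that marks its vertices in $F\times\mathbb N$ by $1$; the profile $h_v$ of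 a vertex $v$ is the lexicographically maximal profile of a path from level $0$ to $v$. Let $G'$ be the run dag without those edges $(u,v)$ for which there is an edge $(u',v)$ with $h_u<h_{u'}$. The level $k$ is $F$-finite for $w$ if every vertex $(q,i)$ with $q\in F$, $i>k$ has only finitely many descendants in $G'$. **Theorem.** Let $A$ be an NBW. All successors named above exist and are unique, so $A_L$ is a well-defined NBW with finitely many states, and: 1. $L(A_L)=\Sigma^\omega\setminus L(A)$. 2. For every letter, a first-stage state has exactly two successors, one in each stage, and a second-stage state has exactly one, which is in the second stage. So $A_L$ is deterministic in the limit, with nondeterminism of degree $2$. 3. For all $w\in\Sigma^\omega$ and $k\in\mathbb N$, $A_L$ has an accepting run on $w$ that is in the first stage exactly at the positions $0,\dots,k$ if and only if $k$ is an $F$-finite level for $w$. 4. Every reachable state of $A_L$ is a preordered subset or a pair $(f,O)$ with $O\subseteq even(f)$. With $y>1$ the real root of $y^3=y^2+1$ and $\kappa=1/(e\ln y)$, so that $0.962<\kappa<0.963$, there is an absolute constant $C$ such that, for every NBW with $n\ge1$ states, the number of states of $A_L$ of this form is at most $C\sqrt n\,(\kappa n)^n$. -/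

import Mathlib

open Set Filter

universe u v

/-- A nondeterministic Büchi automaton on infinite words over the alphabet `α` with state set `Q`.
Finiteness of `α` and `Q` is a hypothesis wherever it is needed. -/
structure NBW (α : Type u) (Q : Type v) where
  /-- the initial states -/
  init : Set Q
  /-- the transition relation, as a map to sets of successors -/
  step : Q → α → Set Q
  /-- the accepting states -/
  acc : Set Q

namespace NBW

variable {α : Type u} {Q : Type v}

/-! ### Büchi automata -/

/-- The transition relation lifted to sets of states. -/
def stepSet (A : NBW α Q) (R : Set Q) (σ : α) : Set Q := ⋃ q ∈ R, A.step q σ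

/-- `p` is an (infinite) run of `A` on the infinite word `w`. -/
def IsRun (A : NBW α Q) (w : ℕ → α) (p : ℕ → Q) : Prop :=
  p 0 ∈ A.init ∧ ∀ i, p (i + 1) ∈ A.step (p i) (w i)

/-- A run is accepting if it is in an accepting state infinitely often. -/
def IsAcceptingRun (A : NBW α Q) (w : ℕ → α) (p : ℕ → Q) : Prop :=
  A.IsRun w p ∧ ∃ᶠ i in atTop, p i ∈ A.acc

/-- The language of `A`: the infinite words on which `A` has an accepting run. -/
def language (A : NBW α Q) : Set (ℕ → α) := {w | ∃ p, A.IsAcceptingRun w p}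

/-- `t` is reachable from `s` (in zero or more steps). -/
def ReachableFrom (A : NBW α Q) (s t : Q) : Prop :=
  Relation.ReflTransGen (fun x y => ∃ σ, y ∈ A.step x σ) s t

/-- The states that are reachable from an initial state. -/
def reachable (A : NBW α Q) : Set Q := {t | ∃ s ∈ A.init, A.ReachableFrom s t}

/-- A state is deterministic if it has at most one successor for every letter. -/
def IsDeterministicState (A : NBW α Q) (q : Q) : Prop := ∀ σ, (A.step q σ).encard ≤ 1

/-- Every state reachable from an accepting state is deterministic. -/
def DeterministicInTheLimit (A : NBW α Q) : Prop :=
  ∀ s ∈ A.acc, ∀ t, A.ReachableFrom s t → A.IsDeterministicState t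

/-! ### The run dag, profiles, and `F`-finite levels -/

/-- The first `i + 1` entries of `b` form an initial path of the run dag of `A` on `w`
(equivalently, a finite run); the entries after position `i` are irrelevant. -/
def IsInitialPath (A : NBW α Q) (w : ℕ → α) (i : ℕ) (b : ℕ → Q) : Prop :=
  b 0 ∈ A.init ∧ ∀ j < i, b (j + 1) ∈ A.step (b j) (w j)

/-- The vertices `(q, i)` of the run dag of `A` on `w`. -/
def dagNodes (A : NBW α Q) (w : ℕ → α) : Set (Q × ℕ) :=
  {u | ∃ b, A.IsInitialPath w u.2 b ∧ b u.2 = u.1}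

open Classical in
/-- The profile of the path `b 0, …, b i`: `true` marks the `F`-nodes. -/
noncomputable def pathProfile (A : NBW α Q) (i : ℕ) (b : ℕ → Q) : List Bool :=
  (List.range (i + 1)).map fun j => decide (b j ∈ A.acc)

/-- `h` is the profile of the node `u`: the lexicographically maximal profile of the initial paths
to `u`. -/
def IsNodeProfile (A : NBW α Q) (w : ℕ → α) (u : Q × ℕ) (h : List Bool) : Prop :=
  IsGreatest {h' | ∃ b, A.IsInitialPath w u.2 b ∧ b u.2 = u.1 ∧ h' = A.pathProfile u.2 b} h

/-- The profile of `u` is lexicographically smaller than the profile of `v`. -/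
def ProfileLT (A : NBW α Q) (w : ℕ → α) (u v : Q × ℕ) : Prop :=
  ∃ h h', A.IsNodeProfile w u h ∧ A.IsNodeProfile w v h' ∧ h < h'

/-- The edges of the run dag of `A` on `w`. -/
def dagEdge (A : NBW α Q) (w : ℕ → α) (u v : Q × ℕ) : Prop :=
  u ∈ A.dagNodes w ∧ v.2 = u.2 + 1 ∧ v.1 ∈ A.step u.1 (w u.2)

/-- The edges of the pruned run dag: an edge `(u, v)` is removed if there is an edge `(u', v)` whose
source has a larger profile. -/
def prunedEdge (A : NBW α Q) (w : ℕ → α) (u v : Q × ℕ) : Prop :=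
  A.dagEdge w u v ∧ ¬ ∃ u', A.dagEdge w u' v ∧ A.ProfileLT w u u'

/-- The node `u` has only finitely many descendants in the pruned run dag. -/
def FiniteInPruned (A : NBW α Q) (w : ℕ → α) (u : Q × ℕ) : Prop :=
  {v | Relation.ReflTransGen (A.prunedEdge w) u v}.Finite

/-- `k` is an `F`-finite level of the run dag of `A` on `w`: all `F`-nodes on levels after `k` are
finite in the pruned run dag. -/
def IsFFiniteLevel (A : NBW α Q) (w : ℕ → α) (k : ℕ) : Prop :=
  ∀ u ∈ A.dagNodes w, u.1 ∈ A.acc → k < u.2 → A.FiniteInPruned w u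

/-! ### Preordered subsets: the first stage -/

end NBW

/-- A preordered subset of `Q`: a set of states with a total preorder on it. The relation `le` is
false outside of the carrier, so that two preordered subsets are equal iff their carriers and their
preorders are. -/
@[ext]
structure PreorderedSubset (Q : Type v) where
  carrier : Set Q
  le : Q → Q → Prop
  mem_of_le : ∀ q r, le q r → q ∈ carrier ∧ r ∈ carrier
  trans : ∀ q r s, le q r → le r s → le q s
  /-- Totality; with `q = r` this is reflexivity. -/
  total : ∀ q ∈ carrier, ∀ r ∈ carrier, le q r ∨ le r q

namespace PreorderedSubset

variable {Q : Type v}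

/-- The strict part of the preorder. -/
def lt (S : PreorderedSubset Q) (q r : Q) : Prop := S.le q r ∧ ¬ S.le r q

/-- The equivalence relation of the preorder. -/
def equiv (S : PreorderedSubset Q) (q r : Q) : Prop := S.le q r ∧ S.le r q

end PreorderedSubset

namespace NBW

variable {α : Type u} {Q : Type v}

/-- The initial preordered subset: the initial states, where `q ⪯ r` iff `q ∉ F` or `r ∈ F`. -/
def initialSubset (A : NBW α Q) : PreorderedSubset Q where
  carrier := A.init
  le q r := q ∈ A.init ∧ r ∈ A.init ∧ (q ∉ A.acc ∨ r ∈ A.acc)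
  mem_of_le _ _ h := ⟨h.1, h.2.1⟩
  trans _ _ _ h h' := ⟨h.1, h'.2.1, by tauto⟩
  total q hq r hr := by tauto

/-- The transitions from `q` that are not dominated by a transition from a larger state of `S`. -/
def prunedStep (A : NBW α Q) (S : PreorderedSubset Q) (q : Q) (σ : α) : Set Q :=
  {r | r ∈ A.step q σ ∧ ∀ q' ∈ S.carrier, r ∈ A.step q' σ → S.le q' q}

/-- `S'` is the `σ`-successor of the preordered subset `S`. -/
def IsSubsetSuccessor (A : NBW α Q) (σ : α) (S S' : PreorderedSubset Q) : Prop :=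
  S'.carrier = A.stepSet S.carrier σ ∧
  ∀ q ∈ S.carrier, ∀ r ∈ S.carrier, ∀ q' ∈ A.prunedStep S q σ, ∀ r' ∈ A.prunedStep S r σ,
    (S.lt q r → S'.lt q' r') ∧
    (S.equiv q r → (q' ∈ A.acc ↔ r' ∈ A.acc) → S'.equiv q' r') ∧
    (S.equiv q r → q' ∉ A.acc → r' ∈ A.acc → S'.lt q' r')

/-! ### Level rankings: the second stage

A level ranking is a function `f : Q → Option ℕ`, where `none` stands for `⊥`. -/

/-- `f` is an `l`-bounded level ranking. -/
def IsLevelRanking (A : NBW α Q) (l : ℕ) (f : Q → Option ℕ) : Prop :=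
  ∀ q r, f q = some r → r ≤ l ∧ (q ∈ A.acc → Even r)

/-- All odd numbers up to the maximal rank are ranks. -/
def IsTight (f : Q → Option ℕ) : Prop :=
  ∀ q r, f q = some r → ∀ i ≤ r, Odd i → ∃ q', f q' = some i

/-- The bound `m = 2 |Q \ F|` on the ranks. -/
noncomputable def rankBound (A : NBW α Q) : ℕ := 2 * (A.accᶜ).ncard

/-- The tight level rankings bounded by `m`. -/
def TightRanking (A : NBW α Q) : Type v :=
  {f : Q → Option ℕ // A.IsLevelRanking A.rankBound f ∧ IsTight f}

/-- The states of even rank. -/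
def evenStates (f : Q → Option ℕ) : Set Q := {q | ∃ r, f q = some r ∧ Even r}

/-- The states of odd rank. -/
def oddStates (f : Q → Option ℕ) : Set Q := {q | ∃ r, f q = some r ∧ Odd r}

/-- The number of classes of non-`F`-states of `S` that are larger than `q`. -/
noncomputable def classesAbove (A : NBW α Q) (S : PreorderedSubset Q) (q : Q) : ℕ :=
  {c : Set Q | ∃ v, v ∈ S.carrier ∧ v ∉ A.acc ∧ S.lt q v ∧ c = {x | S.equiv x v}}.ncard

open Classical in
/-- The level ranking that is read off a preordered subset when the automaton changes stage. -/
noncomputable def toRank (A : NBW α Q) (S : PreorderedSubset Q) (q : Q) : Option ℕ :=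
  if q ∉ S.carrier then none
  else if q ∈ A.acc then some (2 * A.classesAbove S q)
  else some (2 * A.classesAbove S q + 1)

open Classical in
/-- Remove the unused odd ranks: a rank `r` becomes `2 γ` or `2 γ + 1` with the parity of `r`, where
`γ` is the number of odd ranks below `r` that are in use. -/
noncomputable def tighten (f : Q → Option ℕ) (q : Q) : Option ℕ :=
  (f q).map fun r =>
    if Even r then 2 * {i | Odd i ∧ i < r ∧ ∃ q', f q' = some i}.ncard
    else 2 * {i | Odd i ∧ i < r ∧ ∃ q', f q' = some i}.ncard + 1

/-- The ranks of the predecessors of `q'` under `σ`. -/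
def predRanks (A : NBW α Q) (σ : α) (f : Q → Option ℕ) (q' : Q) : Set ℕ :=
  {r | ∃ q, q' ∈ A.step q σ ∧ f q = some r}

open Classical in
/-- Every state inherits the least rank of its predecessors, rounded down to an even number at the
`F`-states. -/
noncomputable def inheritRank (A : NBW α Q) (σ : α) (f : Q → Option ℕ) (q' : Q) : Option ℕ :=
  if A.predRanks σ f q' = ∅ then none
  else if q' ∈ A.acc then some (2 * (sInf (A.predRanks σ f q') / 2))
  else some (sInf (A.predRanks σ f q'))

/-- The `σ`-successor of a level ranking. -/
noncomputable def rankSuccessor (A : NBW α Q) (σ : α) (f : Q → Option ℕ) : Q → Option ℕ :=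
  tighten (A.inheritRank σ f)

open Classical in
/-- The update of the obligation set `O` in the Miyano–Hayashi cut-point construction, where `f'` is
the new level ranking. -/
noncomputable def nextObligation (A : NBW α Q) (σ : α) (O : Set Q) (f' : Q → Option ℕ) : Set Q :=
  if O = ∅ then evenStates f' else A.stepSet O σ \ oddStates f'

/-! ### The complementary automaton -/

/-- The states: preordered subsets (first stage), and pairs of a tight level ranking and an
obligation set (second stage). -/
abbrev RetroState (A : NBW α Q) : Type v := PreorderedSubset Q ⊕ (A.TightRanking × Set Q)

/-- The transition relation of the complementary automaton. -/
def retroStep (A : NBW α Q) : A.RetroState → α → Set A.RetroState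
  | .inl S, σ =>
      {t | ∃ S', A.IsSubsetSuccessor σ S S' ∧
        (t = .inl S' ∨ ∃ f : A.TightRanking, f.1 = A.toRank S' ∧ t = .inr (f, ∅))}
  | .inr (f, O), σ =>
      {t | ∃ f' : A.TightRanking, f'.1 = A.rankSuccessor σ f.1 ∧
        t = .inr (f', A.nextObligation σ O f'.1)}

/-- The complementary automaton `A_L`. -/
def retro (A : NBW α Q) : NBW α A.RetroState where
  init := {.inl A.initialSubset}
  step := A.retroStep
  acc := {t | ∃ f : A.TightRanking, t = .inr (f, ∅)}

/-- The states of the complementary automaton whose obligation set, if there is one, holds states of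
even rank only. -/
def evenObligationStates (A : NBW α Q) : Set A.RetroState :=
  {t | ∀ (f : A.TightRanking) (O : Set Q), t = .inr (f, O) → O ⊆ evenStates f.1}

end NBW

/-! The preorder of the i-th first-stage state compares the profiles of the nodes on level i, so the
pruned transitions are exactly the edges of G' (`exists_nodeProfile`, `prunedEdge_iff`). Equivalent
nodes have equal profiles, hence agree on membership in F.

A rejected word has an F-finite level (`exists_isFFiniteLevel`). Take a level with the largest
possible set of pairwise inequivalent nodes having infinitely many descendants in G', and follow
infinite paths of G' from them. Inequivalence persists along G', so by maximality every later
infinite node is equivalent to a node on one of these finitely many paths. If F-nodes with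
infinitely many descendants occurred on arbitrarily high levels, one of the paths would visit F
infinitely often.

In the second stage, the rankings remain compatible with the preorders: they are antitone, and
states of equal odd rank are equivalent (`RankCompatible`). Along an edge of G' the rank does not
increase, and it is even at the target iff it was even at the source or the target is in F. So the
nodes of even rank after level k are the G'-descendants of F-nodes after k. If O is empty infinitely
often, such descendants enter O at a reset and have died out by the next one, so k is F-finite;
moreover, the ranks along an accepting run of A would be eventually constant and even, which would
keep the run in O forever (`isFFiniteLevel`, `notMem_language`). Conversely, if O is eventually
nonempty, the maximal rank in O stabilises, and tracing the nodes of that rank back along G' yields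
an F-node after k with infinitely many descendants (`frequently_obligation_eq_empty`).

For the count, peel the ranks 0 and 1 off a pair (f, O). If J is the set of states with these ranks
and rank 1 occurs, there are 3^|J| - 2^|J| choices on J, and the rest is a pair on the complement.
The resulting recursion has the exponential generating function e^(3x) / (1 - e^(3x) + e^(2x)),
whose pole is x = ln y. This bounds the number of pairs by y^3 n!/x^n, and Stirling's formula
finishes (`renewal_bound`, `ncard_tightPairs_le`). Preordered subsets inject into such pairs with O
empty. -/

/-! ### Analytic estimates for the number of states -/

theorem exists_root_cube_eq_sq_add_one :
    ∃ y : ℝ, 1.4655 < y ∧ y < 1.4656 ∧ y ^ 3 = y ^ 2 + 1 := by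
  have hc : ContinuousOn (fun y : ℝ => y ^ 3 - y ^ 2) (Set.Icc 1.4655 1.4656) := by fun_prop
  obtain ⟨y, ⟨h1, h2⟩, h3⟩ := intermediate_value_Ioo (by norm_num) hc
    (show (1 : ℝ) ∈ Set.Ioo _ _ by constructor <;> norm_num)
  exact ⟨y, h1, h2, by linarith [show y ^ 3 - y ^ 2 = 1 from h3]⟩

/-- Both bounds come from the degree-6 Taylor polynomial of exp, with a remainder term on the upper
side. They are just sharp enough for three digits of κ. -/
theorem log_bounds_of_mem_Ioo {y : ℝ} (h1 : 1.4655 < y) (h2 : y < 1.4656) :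
    0.38205 < Real.log y ∧ Real.log y < 0.3824 := by
  have hy : 0 < y := by linarith
  constructor
  · rw [Real.lt_log_iff_exp_lt hy]
    refine lt_of_le_of_lt (Real.exp_bound' (by norm_num) (by norm_num) (n := 7) (by norm_num)) ?_
    refine lt_trans ?_ h1
    norm_num [Finset.sum_range_succ, Nat.factorial]
  · rw [Real.log_lt_iff_lt_exp hy]
    refine lt_of_lt_of_le ?_ (Real.sum_le_exp_of_nonneg (by norm_num) 7)
    refine lt_trans h2 ?_
    norm_num [Finset.sum_range_succ, Nat.factorial]

theorem inv_exp_mul_log_bounds {y : ℝ} (h1 : 1.4655 < y) (h2 : y < 1.4656) :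
    0.962 < 1 / (Real.exp 1 * Real.log y) ∧ 1 / (Real.exp 1 * Real.log y) < 0.963 := by
  obtain ⟨hl, hu⟩ := log_bounds_of_mem_Ioo h1 h2
  have he := Real.exp_one_gt_d9
  have he' := Real.exp_one_lt_d9
  have hpos : 0 < Real.exp 1 * Real.log y := mul_pos (Real.exp_pos 1) (by linarith)
  constructor
  · rw [lt_div_iff₀ hpos]
    nlinarith
  · rw [div_lt_iff₀ hpos]
    nlinarith

/-- Stirling's sequence n!/(√(2n) (n/e)^n) decreases from its value e/√2 at n = 1; this is where the
factor e comes from. -/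
theorem factorial_le_exp_mul_sqrt_mul_pow {n : ℕ} (hn : 1 ≤ n) :
    (n.factorial : ℝ) ≤ Real.exp 1 * √n * (n / Real.exp 1) ^ n := by
  obtain ⟨k, rfl⟩ : ∃ k, n = k + 1 := ⟨n - 1, by omega⟩
  have h := Stirling.stirlingSeq'_antitone (Nat.zero_le k)
  simp only [Function.comp_apply, Nat.succ_eq_add_one, zero_add, Stirling.stirlingSeq_one] at h
  rw [Stirling.stirlingSeq, div_le_iff₀ (by positivity)] at h
  refine h.trans (le_of_eq ?_)
  rw [Real.sqrt_mul (by norm_num)]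
  field_simp

/-- The full series sums to e^(3x) - e^(2x) = y^3 - y^2 = 1, and its terms are nonnegative. -/
theorem sum_exp_coeff_sub_le {x y : ℝ} (hx : 0 ≤ x) (hy : Real.exp x = y)
    (hroot : y ^ 3 = y ^ 2 + 1) (n : ℕ) :
    ∑ j ∈ Finset.range n, ((3 * x) ^ j - (2 * x) ^ j) / (j.factorial : ℝ) ≤ 1 := by
  have key : ∀ t : ℝ, HasSum (fun j : ℕ => t ^ j / (j.factorial : ℝ)) (Real.exp t) := fun t => by
    rw [Real.exp_eq_exp_ℝ]
    exact NormedSpace.expSeries_div_hasSum_exp t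
  have h := (key (3 * x)).sub (key (2 * x))
  have h3 : Real.exp (3 * x) = y ^ 3 := by rw [← hy, ← Real.exp_nat_mul]; norm_num
  have h2 : Real.exp (2 * x) = y ^ 2 := by rw [← hy, ← Real.exp_nat_mul]; norm_num
  rw [h3, h2, hroot, add_sub_cancel_left] at h
  simp only [sub_div]
  refine sum_le_hasSum _ (fun j _ => sub_nonneg.2 ?_) h
  gcongr
  norm_num

/-- The solution of a renewal inequality with exponential generating function
`e ^ (3 x) / (1 - (e ^ (3 x) - e ^ (2 x)))` grows at most like the inverse powers of its pole. -/
theorem renewal_bound {Q : Type v} [DecidableEq Q] {x y : ℝ} (hx : 0 < x) (hy : Real.exp x = y)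
    (hroot : y ^ 3 = y ^ 2 + 1) (w : Finset Q → ℝ)
    (hw : ∀ s, w s ≤ 3 ^ s.card +
      ∑ J ∈ s.powerset.erase ∅, (3 ^ J.card - 2 ^ J.card) * w (s \ J)) (s : Finset Q) :
    w s ≤ s.card.factorial / x ^ s.card *
      ∑ i ∈ Finset.range (s.card + 1), (3 * x) ^ i / (i.factorial : ℝ) := by
  induction s using Finset.strongInduction with
  | H s ih =>
  set n := s.card with hn
  set E : ℕ → ℝ := fun k => ∑ i ∈ Finset.range k, (3 * x) ^ i / (i.factorial : ℝ) with hE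
  have hEmono : Monotone E := fun a b hab =>
    Finset.sum_le_sum_of_subset_of_nonneg (Finset.range_mono hab) fun i _ _ => by positivity
  have h1 : w s ≤ 3 ^ n + ∑ J ∈ s.powerset.erase ∅, ((3 : ℝ) ^ J.card - 2 ^ J.card) *
      ((n - J.card).factorial / x ^ (n - J.card) * E n) := by
    refine (hw s).trans (add_le_add le_rfl (Finset.sum_le_sum fun J hJ => ?_))
    rw [Finset.mem_erase, Finset.mem_powerset] at hJ
    have hJpos : 0 < J.card := Finset.card_pos.2 (Finset.nonempty_iff_ne_empty.2 hJ.1)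
    have hcard : (s \ J).card = n - J.card := Finset.card_sdiff_of_subset hJ.2
    have hJn : J.card ≤ n := Finset.card_le_card hJ.2
    refine mul_le_mul_of_nonneg_left ?_ (sub_nonneg.2 (by gcongr; norm_num))
    refine (ih _ (Finset.sdiff_ssubset hJ.2 (Finset.nonempty_iff_ne_empty.2 hJ.1))).trans ?_
    rw [hcard]
    gcongr
    -- Since J is nonempty, the partial sum for s \ J has at most n terms.
    exact hEmono (by omega)
  have h2 : ∑ J ∈ s.powerset.erase ∅, ((3 : ℝ) ^ J.card - 2 ^ J.card) *
      ((n - J.card).factorial / x ^ (n - J.card) * E n) =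
      ∑ J ∈ s.powerset, ((3 : ℝ) ^ J.card - 2 ^ J.card) *
      ((n - J.card).factorial / x ^ (n - J.card) * E n) := Finset.sum_erase _ (by simp)
  have h3 : ∑ J ∈ s.powerset, ((3 : ℝ) ^ J.card - 2 ^ J.card) *
      ((n - J.card).factorial / x ^ (n - J.card) * E n) =
      n.factorial / x ^ n * E n *
        ∑ j ∈ Finset.range (n + 1), ((3 * x) ^ j - (2 * x) ^ j) / (j.factorial : ℝ) := by
    rw [Finset.sum_powerset_apply_card (fun j => ((3 : ℝ) ^ j - 2 ^ j) *
      ((n - j).factorial / x ^ (n - j) * E n)), Finset.mul_sum]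
    refine Finset.sum_congr rfl fun j hj => ?_
    have hjn : j ≤ n := by rw [Finset.mem_range] at hj; omega
    rw [nsmul_eq_mul, ← hn, Nat.cast_choose ℝ hjn, mul_pow, mul_pow]
    have : x ^ n = x ^ j * x ^ (n - j) := by rw [← pow_add]; congr 1; omega
    rw [this]
    have := Nat.factorial_pos j
    have := Nat.factorial_pos (n - j)
    field_simp
  -- The inhomogeneous term 3^n is exactly the last summand of the partial sum with n + 1 terms, so
  -- the induction closes.
  have h4 : n.factorial / x ^ n * E (n + 1) = 3 ^ n + n.factorial / x ^ n * E n * 1 := by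
    simp only [hE, Finset.sum_range_succ, mul_pow]
    have := Nat.factorial_pos n
    field_simp
    ring
  rw [h2, h3] at h1
  change w s ≤ n.factorial / x ^ n * E (n + 1)
  rw [h4]
  refine h1.trans (add_le_add le_rfl (mul_le_mul_of_nonneg_left
    (sum_exp_coeff_sub_le hx.le hy hroot _) ?_))
  have : 0 ≤ E n := Finset.sum_nonneg fun i _ => by positivity
  positivity

/-! ### Tight rankings with a set of even states -/

section Counting

variable {Q : Type v}

/-- The pairs of a tight ranking of the states in `s` and a set of states of even rank. -/
def tightPairs (s : Set Q) : Set ((Q → Option ℕ) × Set Q) :=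
  {p | (∀ q r, p.1 q = some r → q ∈ s) ∧ NBW.IsTight p.1 ∧ p.2 ⊆ NBW.evenStates p.1}

/-- If all states of odd rank are in `s`, then the ranks of a tight ranking are at most `2 |s|`. -/
theorem NBW.IsTight.rank_le [Finite Q] {f : Q → Option ℕ} (hf : NBW.IsTight f) {s : Set Q}
    (hs : ∀ q r, f q = some r → Odd r → q ∈ s) {q : Q} {r : ℕ} (hq : f q = some r) :
    r ≤ 2 * s.ncard := by
  -- There are (r + 1) / 2 odd numbers up to r; tightness gives each of them a state, and these
  -- states are distinct elements of s.
  have h : ∀ j : Fin ((r + 1) / 2), ∃ q', f q' = some (2 * j.1 + 1) := fun j =>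
    hf q r hq (2 * j.1 + 1) (by omega) ⟨j.1, rfl⟩
  choose g hg using h
  have hinj : Function.Injective g := fun i j hij => by
    have := (hg i).symm.trans (hij ▸ hg j)
    simp only [Option.some.injEq] at this
    exact Fin.ext (by omega)
  have hsub : Set.range g ⊆ s := by
    rintro _ ⟨j, rfl⟩
    exact hs _ _ (hg j) ⟨j.1, rfl⟩
  have h1 := Set.ncard_le_ncard hsub (Set.toFinite _)
  rw [← Set.image_univ, Set.ncard_image_of_injective _ hinj, Set.ncard_univ, Nat.card_fin] at h1
  omega

theorem finite_setOf_rank_le [Finite Q] (l : ℕ) :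
    {f : Q → Option ℕ | ∀ q r, f q = some r → r ≤ l}.Finite := by
  refine (Set.Finite.pi' (t := fun _ : Q => insert none (some '' Set.Iic l)) fun _ =>
    ((Set.finite_Iic l).image _).insert _).subset fun f hf q => ?_
  cases h : f q with
  | none => exact Or.inl rfl
  | some r => exact Or.inr ⟨r, hf q r h, rfl⟩

theorem tightPairs_finite [Finite Q] (s : Set Q) : (tightPairs s).Finite :=
  ((finite_setOf_rank_le (2 * (Set.univ : Set Q).ncard)).prod (Set.toFinite Set.univ)).subset
    fun _ hp => ⟨fun _ _ h => hp.2.1.rank_le (fun _ _ _ _ => Set.mem_univ _) h, Set.mem_univ _⟩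

/-- Value 1 stands for rank 1, and values 0 and 2 for rank 0 outside and inside O. The excluded maps
take only the values 0 and 2. -/
theorem card_fin_three_with_one (J : Finset Q) :
    {g : J → Fin 3 | ∃ q, g q = 1}.ncard = 3 ^ J.card - 2 ^ J.card := by
  classical
  have h : {g : J → Fin 3 | ∃ q, g q = 1} =
      (↑(Fintype.piFinset fun _ : J => ({0, 2} : Finset (Fin 3))) : Set (J → Fin 3))ᶜ := by
    ext g
    simp only [Set.mem_ofPred_eq, Set.mem_compl_iff, Finset.mem_coe, Fintype.mem_piFinset,
      Finset.mem_insert, Finset.mem_singleton, not_forall]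
    refine exists_congr fun q => ?_
    generalize g q = a
    fin_cases a <;> simp
  rw [h, Set.ncard_compl, Set.ncard_coe_finset, Fintype.card_piFinset]
  simp

open Classical in
/-- The ranking that remains after the ranks `0` and `1` have been removed. -/
noncomputable def lowerRanks (f : Q → Option ℕ) (q : Q) : Option ℕ :=
  (f q).bind fun r => if 2 ≤ r then some (r - 2) else none

theorem lowerRanks_eq_some {f : Q → Option ℕ} {q : Q} {r : ℕ} :
    lowerRanks f q = some r ↔ f q = some (r + 2) := by
  unfold lowerRanks
  cases h : f q with
  | none => simp
  | some t =>
    by_cases ht : 2 ≤ t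
    · simp only [Option.bind_some, ht, if_true, Option.some.injEq]; omega
    · simp only [Option.bind_some, ht, if_false, Option.some.injEq, reduceCtorEq, false_iff]
      omega

open Classical in
/-- The coding of a pair that marks the states of value `a` and the states of the set. -/
noncomputable def markCode (a : Option ℕ) (p : (Q → Option ℕ) × Set Q) (q : Q) : Fin 3 :=
  if p.1 q = a then 1 else if q ∈ p.2 then 2 else 0

theorem markCode_eq_one {a : Option ℕ} {p : (Q → Option ℕ) × Set Q} {q : Q} :
    markCode a p q = 1 ↔ p.1 q = a := by
  unfold markCode
  split_ifs <;> simp [*]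

theorem markCode_eq_two {a : Option ℕ} {p : (Q → Option ℕ) × Set Q} {q : Q}
    (h : q ∈ p.2 → p.1 q ≠ a) : markCode a p q = 2 ↔ q ∈ p.2 := by
  unfold markCode
  split_ifs with h1 h2
  · exact iff_of_false (by decide) fun h2 => h h2 h1
  · exact iff_of_true rfl h2
  · exact iff_of_false (by decide) h2

/-- Without rank 1, tightness leaves only ⊥ and rank 0. Each state of s is then in one of three
situations: rank ⊥, rank 0 in O, rank 0 outside O. -/
theorem ncard_tightPairs_no_one [Finite Q] (s : Finset Q) :
    {p ∈ tightPairs (s : Set Q) | ∀ q, p.1 q ≠ some 1}.ncard ≤ 3 ^ s.card := by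
  classical
  have hcard : (Set.univ : Set (s → Fin 3)).ncard = 3 ^ s.card := by
    rw [Set.ncard_univ, Nat.card_eq_fintype_card]; simp
  rw [← hcard]
  have hzero : ∀ p ∈ {p ∈ tightPairs (s : Set Q) | ∀ q, p.1 q ≠ some 1}, ∀ q r,
      p.1 q = some r → r = 0 := fun p hp q r hr => by
    by_contra h0
    obtain ⟨q', hq'⟩ := hp.1.2.1 q r hr 1 (by omega) odd_one
    exact hp.2 q' hq'
  refine Set.ncard_le_ncard_of_injOn (fun p (q : s) => markCode none p q.1)
    (fun _ _ => Set.mem_univ _) ?_ (Set.toFinite _)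
  intro p hp p' hp' h
  have hcode : ∀ q ∈ s, markCode none p q = markCode none p' q := fun q hq => congrFun h ⟨q, hq⟩
  have hval : ∀ p ∈ {p ∈ tightPairs (s : Set Q) | ∀ q, p.1 q ≠ some 1}, ∀ q,
      p.1 q = none ∨ p.1 q = some 0 := fun p hp q => by
    cases hq : p.1 q with
    | none => exact Or.inl rfl
    | some r => rw [hzero p hp q r hq]; exact Or.inr rfl
  have hmem : ∀ p ∈ {p ∈ tightPairs (s : Set Q) | ∀ q, p.1 q ≠ some 1}, ∀ q ∈ p.2,
      p.1 q = some 0 := fun p hp q hq => by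
    obtain ⟨r, hr, -⟩ := hp.1.2.2 hq
    rw [hr, hzero p hp q r hr]
  have hout : ∀ p ∈ {p ∈ tightPairs (s : Set Q) | ∀ q, p.1 q ≠ some 1}, ∀ q ∉ s,
      p.1 q = none := fun p hp q hq => by
    cases hr : p.1 q with
    | none => rfl
    | some r => exact absurd (hp.1.1 q r hr) hq
  have key : ∀ q, p.1 q = p'.1 q ∧ (q ∈ p.2 ↔ q ∈ p'.2) := fun q => by
    by_cases hq : q ∈ s
    · have hc := hcode q hq
      have m1 : q ∈ p.2 → p.1 q ≠ none := fun h => by simp [hmem p hp q h]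
      have m2 : q ∈ p'.2 → p'.1 q ≠ none := fun h => by simp [hmem p' hp' q h]
      have e1 : p.1 q = none ↔ p'.1 q = none := by
        rw [← markCode_eq_one (p := p), hc, markCode_eq_one]
      refine ⟨?_, by rw [← markCode_eq_two m1, hc, markCode_eq_two m2]⟩
      rcases hval p hp q with h1 | h1
      · rw [h1, e1.1 h1]
      · rcases hval p' hp' q with h2 | h2
        · rw [h2, e1.2 h2]
        · rw [h1, h2]
    · have h1 := hout p hp q hq
      have h2 := hout p' hp' q hq
      have m1 := hmem p hp q
      have m2 := hmem p' hp' q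
      rw [h1] at m1
      rw [h2] at m2
      refine ⟨h1.trans h2.symm, ?_⟩
      simp at m1 m2
      tauto
  exact Prod.ext (funext fun q => (key q).1) (Set.ext fun q => (key q).2)

/-- A pair is determined by its code on J and by what remains after the ranks have been lowered by
2. The remainder is again tight, its even states are the old ones outside J, and it lives on s \ J.
-/
theorem ncard_tightPairs_low [Finite Q] [DecidableEq Q] (s J : Finset Q) :
    {p ∈ tightPairs (s : Set Q) | (∀ q, q ∈ J ↔ p.1 q = some 0 ∨ p.1 q = some 1) ∧
      ∃ q, p.1 q = some 1}.ncard ≤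
      (3 ^ J.card - 2 ^ J.card) * (tightPairs ((s \ J : Finset Q) : Set Q)).ncard := by
  rw [← card_fin_three_with_one, ← Set.ncard_prod]
  refine Set.ncard_le_ncard_of_injOn
    (fun p => (fun q : J => markCode (some 1) p q.1, lowerRanks p.1, p.2 \ (J : Set Q))) ?_ ?_
    ((Set.toFinite _).prod (tightPairs_finite _))
  · rintro p ⟨⟨hs, ht, he⟩, hJ, q, hq⟩
    refine ⟨⟨⟨q, (hJ q).2 (Or.inr hq)⟩, markCode_eq_one.2 hq⟩, ?_, ?_, ?_⟩
    · intro q r hr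
      rw [lowerRanks_eq_some] at hr
      simp only [Finset.coe_sdiff, Set.mem_sdiff, Finset.mem_coe]
      refine ⟨hs q _ hr, fun h => ?_⟩
      rw [hJ, hr] at h
      simp at h
    · intro q r hr i hi ho
      simp only [lowerRanks_eq_some] at hr ⊢
      exact ht q _ hr (i + 2) (by omega) (by simpa [parity_simps] using ho)
    · rintro q ⟨hq, hqJ⟩
      obtain ⟨r, hr, hre⟩ := he hq
      have h0 : r ≠ 0 := fun h => hqJ (Finset.mem_coe.2 ((hJ q).2 (Or.inl (h ▸ hr))))
      have h1 : r ≠ 1 := fun h => hqJ (Finset.mem_coe.2 ((hJ q).2 (Or.inr (h ▸ hr))))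
      obtain ⟨t, rfl⟩ : ∃ t, r = t + 2 := ⟨r - 2, by omega⟩
      exact ⟨t, lowerRanks_eq_some.2 hr, by simpa [parity_simps] using hre⟩
  · rintro p ⟨⟨-, -, he⟩, hJ, -⟩ p' ⟨⟨-, -, he'⟩, hJ', -⟩ h
    simp only [Prod.mk.injEq] at h
    obtain ⟨hc, hr, ho⟩ := h
    have key : ∀ q, p.1 q = p'.1 q ∧ (q ∈ p.2 ↔ q ∈ p'.2) := fun q => by
      by_cases hq : q ∈ J
      · have hcq : markCode (some 1) p q = markCode (some 1) p' q := congrFun hc ⟨q, hq⟩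
        have m1 : q ∈ p.2 → p.1 q ≠ some 1 := fun hm h1 => by
          obtain ⟨r, hr, hre⟩ := he hm
          rw [hr, Option.some.injEq] at h1
          subst h1
          exact absurd hre (by decide)
        have m2 : q ∈ p'.2 → p'.1 q ≠ some 1 := fun hm h1 => by
          obtain ⟨r, hr, hre⟩ := he' hm
          rw [hr, Option.some.injEq] at h1
          subst h1
          exact absurd hre (by decide)
        have e1 : p.1 q = some 1 ↔ p'.1 q = some 1 := by
          rw [← markCode_eq_one (p := p), hcq, markCode_eq_one]
        refine ⟨?_, by rw [← markCode_eq_two m1, hcq, markCode_eq_two m2]⟩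
        rcases (hJ q).1 hq with h1 | h1
        · rcases (hJ' q).1 hq with h2 | h2
          · rw [h1, h2]
          · rw [h2, e1.2 h2]
        · rw [h1, e1.1 h1]
      · have hrq := fun r => (lowerRanks_eq_some (r := r)).symm.trans
          ((Eq.congr_left (congrFun hr q)).trans (lowerRanks_eq_some (f := p'.1) (q := q)))
        have hoq : q ∈ p.2 \ (J : Set Q) ↔ q ∈ p'.2 \ (J : Set Q) := by rw [ho]
        simp only [Set.mem_sdiff, Finset.mem_coe, hq, not_false_eq_true, and_true] at hoq
        refine ⟨?_, hoq⟩
        have n1 := fun h => hq ((hJ q).2 h)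
        have n2 := fun h => hq ((hJ' q).2 h)
        ext t
        match t with
        | 0 => exact iff_of_false (fun h => n1 (Or.inl h)) (fun h => n2 (Or.inl h))
        | 1 => exact iff_of_false (fun h => n1 (Or.inr h)) (fun h => n2 (Or.inr h))
        | t + 2 => exact hrq t
    exact Prod.ext (funext fun q => (key q).1) (Set.ext fun q => (key q).2)

/-- If rank 1 is used, sort the pairs by the set J of states of rank 0 or 1, which is then nonempty.
-/
theorem ncard_tightPairs_le [Finite Q] [DecidableEq Q] (s : Finset Q) :
    (tightPairs (s : Set Q)).ncard ≤ 3 ^ s.card + ∑ J ∈ s.powerset.erase ∅,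
      (3 ^ J.card - 2 ^ J.card) * (tightPairs ((s \ J : Finset Q) : Set Q)).ncard := by
  classical
  set V : Finset Q → Set ((Q → Option ℕ) × Set Q) := fun J =>
    {p ∈ tightPairs (s : Set Q) | (∀ q, q ∈ J ↔ p.1 q = some 0 ∨ p.1 q = some 1) ∧
      ∃ q, p.1 q = some 1} with hV
  have hsub : tightPairs (s : Set Q) ⊆ {p ∈ tightPairs (s : Set Q) | ∀ q, p.1 q ≠ some 1} ∪
      ⋃ J ∈ s.powerset.erase ∅, V J := by
    intro p hp
    by_cases h1 : ∃ q, p.1 q = some 1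
    · refine Or.inr ?_
      have hmem : ∀ q, q ∈ s.filter (fun q => p.1 q = some 0 ∨ p.1 q = some 1) ↔
          p.1 q = some 0 ∨ p.1 q = some 1 := fun q => by
        rw [Finset.mem_filter, and_iff_right_iff_imp]
        rintro (h | h) <;> exact hp.1 q _ h
      obtain ⟨q, hq⟩ := h1
      refine Set.mem_biUnion (x := s.filter fun q => p.1 q = some 0 ∨ p.1 q = some 1) ?_
        ⟨hp, hmem, q, hq⟩
      rw [Finset.mem_coe, Finset.mem_erase, Finset.mem_powerset]
      exact ⟨Finset.ne_empty_of_mem ((hmem q).2 (Or.inr hq)), Finset.filter_subset _ _⟩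
    · exact Or.inl ⟨hp, not_exists.1 h1⟩
  have hfin : ∀ J, (V J).Finite := fun J => (tightPairs_finite _).subset (Set.sep_subset _ _)
  refine (Set.ncard_le_ncard hsub (((tightPairs_finite _).subset (Set.sep_subset _ _)).union
    (Set.Finite.biUnion (Finset.finite_toSet _) fun J _ => hfin J))).trans ?_
  refine (Set.ncard_union_le _ _).trans (add_le_add (ncard_tightPairs_no_one s) ?_)
  refine (Finset.set_ncard_biUnion_le _ _).trans (Finset.sum_le_sum fun J _ => ?_)
  exact ncard_tightPairs_low s J

theorem ncard_tightPairs_univ_le [Finite Q] {x y : ℝ} (hx : 0 < x) (hy : Real.exp x = y)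
    (hroot : y ^ 3 = y ^ 2 + 1) :
    ((tightPairs (Set.univ : Set Q)).ncard : ℝ) ≤
      (Nat.card Q).factorial / x ^ Nat.card Q * y ^ 3 := by
  classical
  have := Fintype.ofFinite Q
  have h := renewal_bound hx hy hroot
    (fun s : Finset Q => ((tightPairs (s : Set Q)).ncard : ℝ)) (fun s => by
      have h := ncard_tightPairs_le s
      have h' : ((tightPairs (s : Set Q)).ncard : ℝ) ≤ ((3 ^ s.card + ∑ J ∈ s.powerset.erase ∅,
        (3 ^ J.card - 2 ^ J.card) * (tightPairs ((s \ J : Finset Q) : Set Q)).ncard : ℕ) : ℝ) := by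
        exact_mod_cast h
      refine h'.trans (le_of_eq ?_)
      push_cast
      refine congrArg₂ _ rfl (Finset.sum_congr rfl fun J _ => ?_)
      rw [Nat.cast_sub (by gcongr; norm_num)]
      push_cast
      rfl) Finset.univ
  rw [Finset.coe_univ, Finset.card_univ, ← Nat.card_eq_fintype_card] at h
  refine h.trans ?_
  have h3 : Real.exp (3 * x) = y ^ 3 := by rw [← hy, ← Real.exp_nat_mul]; norm_num
  rw [← h3]
  gcongr
  exact Real.sum_le_exp_of_nonneg (by positivity) _

end Counting

/-! ### Finite total preorders -/

namespace PreorderedSubset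

variable {Q : Type v} {S : PreorderedSubset Q} {q r s : Q}

theorem refl (hq : q ∈ S.carrier) : S.le q q := (S.total q hq q hq).elim id id

theorem lt_or_equiv_or_lt (hq : q ∈ S.carrier) (hr : r ∈ S.carrier) :
    S.lt q r ∨ S.equiv q r ∨ S.lt r q := by
  have := S.total q hq r hr
  unfold lt equiv
  tauto

theorem lt_of_not_le (hq : q ∈ S.carrier) (hr : r ∈ S.carrier) (h : ¬ S.le q r) : S.lt r q :=
  ⟨(S.total q hq r hr).resolve_left h, h⟩

theorem lt_of_lt_of_le (h : S.lt q r) (h' : S.le r s) : S.lt q s :=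
  ⟨S.trans _ _ _ h.1 h', fun h2 => h.2 (S.trans _ _ _ h' h2)⟩

theorem lt_of_le_of_lt (h : S.le q r) (h' : S.lt r s) : S.lt q s :=
  ⟨S.trans _ _ _ h h'.1, fun h2 => h'.2 (S.trans _ _ _ h2 h)⟩

theorem exists_greatest [Finite Q] {R : Set Q} (hR : R ⊆ S.carrier) (hne : R.Nonempty) :
    ∃ q ∈ R, ∀ r ∈ R, S.le r q := by
  -- An element with the largest down-set is greatest: totality would give anything not below it a
  -- strictly larger down-set.
  obtain ⟨q, hq, hmax⟩ := Set.exists_max_image R (fun q => {x | S.le x q}.ncard)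
    (Set.toFinite R) hne
  refine ⟨q, hq, fun r hr => ?_⟩
  by_contra hle
  have hlt := lt_of_not_le (hR hr) (hR hq) hle
  refine (hmax r hr).not_gt (Set.ncard_lt_ncard ⟨fun x hx => S.trans _ _ _ hx hlt.1, fun h => ?_⟩
    (Set.toFinite _))
  exact hlt.2 (h (refl (hR hr)))

/-- The preordered subset with the reversed preorder. -/
def dual (S : PreorderedSubset Q) : PreorderedSubset Q where
  carrier := S.carrier
  le q r := S.le r q
  mem_of_le q r h := (S.mem_of_le r q h).symm
  trans q r s h h' := S.trans s r q h' h
  total q hq r hr := S.total r hr q hq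

theorem exists_least [Finite Q] {R : Set Q} (hR : R ⊆ S.carrier) (hne : R.Nonempty) :
    ∃ q ∈ R, ∀ r ∈ R, S.le q r :=
  exists_greatest (S := S.dual) hR hne

instance finite [Finite Q] : Finite (PreorderedSubset Q) :=
  Finite.of_injective (fun S : PreorderedSubset Q => (S.carrier, S.le)) fun S T h => by
    simp only [Prod.mk.injEq] at h
    exact PreorderedSubset.ext h.1 h.2

end PreorderedSubset

namespace NBW

variable {α : Type u} {Q : Type v} {A : NBW α Q} {σ : α} {S T : PreorderedSubset Q}

/-! ### Successors of preordered subsets -/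

theorem mem_stepSet {R : Set Q} {q' : Q} : q' ∈ A.stepSet R σ ↔ ∃ q ∈ R, q' ∈ A.step q σ := by
  simp [stepSet]

/-- Two pruned parents of the same state dominate each other. Hence the successor preorder does not
depend on the choice of parents. -/
theorem equiv_of_mem_prunedStep {q r q' : Q} (hq : q ∈ S.carrier) (hr : r ∈ S.carrier)
    (h : q' ∈ A.prunedStep S q σ) (h' : q' ∈ A.prunedStep S r σ) : S.equiv q r :=
  ⟨h'.2 q hq h.1, h.2 r hr h'.1⟩

theorem exists_mem_prunedStep [Finite Q] {q' : Q} (h : q' ∈ A.stepSet S.carrier σ) :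
    ∃ q ∈ S.carrier, q' ∈ A.prunedStep S q σ := by
  rw [mem_stepSet] at h
  obtain ⟨q, ⟨hq, hs⟩, hmax⟩ := PreorderedSubset.exists_greatest (S := S)
    (R := {q | q ∈ S.carrier ∧ q' ∈ A.step q σ}) (fun _ h => h.1) h
  exact ⟨q, hq, hs, fun r hr hrs => hmax r ⟨hr, hrs⟩⟩

/-- The three clauses amount to a lexicographic comparison, first of the parents' classes and then
of membership in F. Every element of the successor has a pruned parent, so uniqueness follows. -/
theorem IsSubsetSuccessor.le_iff (h : A.IsSubsetSuccessor σ S T) {q r q' r' : Q}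
    (hq : q ∈ S.carrier) (hr : r ∈ S.carrier) (hq' : q' ∈ A.prunedStep S q σ)
    (hr' : r' ∈ A.prunedStep S r σ) :
    T.le q' r' ↔ S.lt q r ∨ S.equiv q r ∧ (q' ∈ A.acc → r' ∈ A.acc) := by
  obtain ⟨h1, h2, h3⟩ := h.2 q hq r hr q' hq' r' hr'
  obtain ⟨k1, -, k3⟩ := h.2 r hr q hq r' hr' q' hq'
  rcases PreorderedSubset.lt_or_equiv_or_lt hq hr with h | h | h
  · exact iff_of_true (h1 h).1 (Or.inl h)
  · by_cases hF : q' ∈ A.acc → r' ∈ A.acc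
    · refine iff_of_true ?_ (Or.inr ⟨h, hF⟩)
      by_cases hF' : r' ∈ A.acc → q' ∈ A.acc
      · exact (h2 h ⟨hF, hF'⟩).1
      · rw [Classical.not_imp] at hF'
        exact (h3 h hF'.2 hF'.1).1
    · rw [Classical.not_imp] at hF
      refine iff_of_false (k3 h.symm hF.2 hF.1).2 ?_
      rintro (h' | ⟨-, h'⟩)
      · exact h'.2 h.2
      · exact hF.2 (h' hF.1)
  · refine iff_of_false (k1 h).2 ?_
    rintro (h' | ⟨h', -⟩)
    · exact h.2 h'.1
    · exact h.2 h'.1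

theorem IsSubsetSuccessor.unique [Finite Q] {T' : PreorderedSubset Q}
    (h : A.IsSubsetSuccessor σ S T) (h' : A.IsSubsetSuccessor σ S T') : T = T' := by
  have hc : T.carrier = T'.carrier := h.1.trans h'.1.symm
  have key : ∀ T T', A.IsSubsetSuccessor σ S T → A.IsSubsetSuccessor σ S T' →
      ∀ q r, T.le q r → T'.le q r := fun T T' h h' q r hqr => by
    obtain ⟨m1, m2⟩ := T.mem_of_le q r hqr
    rw [h.1] at m1 m2
    obtain ⟨p, hp, hpq⟩ := exists_mem_prunedStep m1
    obtain ⟨p', hp', hpr⟩ := exists_mem_prunedStep m2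
    rw [h.le_iff hp hp' hpq hpr] at hqr
    rwa [h'.le_iff hp hp' hpq hpr]
  exact PreorderedSubset.ext hc (funext fun q => funext fun r =>
    propext ⟨key T T' h h' q r, key T' T h' h q r⟩)

/-- The successor of a preordered subset. -/
def subsetSucc [Finite Q] (A : NBW α Q) (σ : α) (S : PreorderedSubset Q) :
    PreorderedSubset Q where
  carrier := A.stepSet S.carrier σ
  le q' r' := ∃ q ∈ S.carrier, ∃ r ∈ S.carrier, q' ∈ A.prunedStep S q σ ∧
    r' ∈ A.prunedStep S r σ ∧ (S.lt q r ∨ S.equiv q r ∧ (q' ∈ A.acc → r' ∈ A.acc))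
  mem_of_le q' r' := by
    rintro ⟨q, hq, r, hr, hq', hr', -⟩
    exact ⟨mem_stepSet.2 ⟨q, hq, hq'.1⟩, mem_stepSet.2 ⟨r, hr, hr'.1⟩⟩
  trans q' r' s' := by
    rintro ⟨q, hq, r, hr, hq', hr', h⟩ ⟨r₂, hr₂, s, hs, hr₂', hs', h'⟩
    refine ⟨q, hq, s, hs, hq', hs', ?_⟩
    have e := equiv_of_mem_prunedStep hr hr₂ hr' hr₂'
    rcases h with h | ⟨h, i⟩
    · refine Or.inl (PreorderedSubset.lt_of_lt_of_le h (S.trans _ _ _ e.1 ?_))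
      exact h'.elim (fun h => h.1) (fun h => h.1.1)
    · rcases h' with h' | ⟨h', i'⟩
      · exact Or.inl (PreorderedSubset.lt_of_le_of_lt (S.trans _ _ _ h.1 e.1) h')
      · exact Or.inr ⟨⟨S.trans _ _ _ (S.trans _ _ _ h.1 e.1) h'.1,
          S.trans _ _ _ h'.2 (S.trans _ _ _ e.2 h.2)⟩, i' ∘ i⟩
  total q' hq' r' hr' := by
    obtain ⟨q, hq, hqq'⟩ := exists_mem_prunedStep hq'
    obtain ⟨r, hr, hrr'⟩ := exists_mem_prunedStep hr'
    rcases PreorderedSubset.lt_or_equiv_or_lt hq hr with h | h | h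
    · exact Or.inl ⟨q, hq, r, hr, hqq', hrr', Or.inl h⟩
    · by_cases hF : q' ∈ A.acc → r' ∈ A.acc
      · exact Or.inl ⟨q, hq, r, hr, hqq', hrr', Or.inr ⟨h, hF⟩⟩
      · exact Or.inr ⟨r, hr, q, hq, hrr', hqq', Or.inr ⟨h.symm, by tauto⟩⟩
    · exact Or.inr ⟨r, hr, q, hq, hrr', hqq', Or.inl h⟩

theorem isSubsetSuccessor_subsetSucc [Finite Q] (A : NBW α Q) (σ : α)
    (S : PreorderedSubset Q) : A.IsSubsetSuccessor σ S (A.subsetSucc σ S) := by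
  have key : ∀ q ∈ S.carrier, ∀ r ∈ S.carrier, ∀ q' ∈ A.prunedStep S q σ,
      ∀ r' ∈ A.prunedStep S r σ, (A.subsetSucc σ S).le q' r' ↔
        S.lt q r ∨ S.equiv q r ∧ (q' ∈ A.acc → r' ∈ A.acc) := fun q hq r hr q' hq' r' hr' => by
    refine ⟨?_, fun h => ⟨q, hq, r, hr, hq', hr', h⟩⟩
    rintro ⟨q₂, hq₂, r₂, hr₂, hq₂', hr₂', h⟩
    have e := equiv_of_mem_prunedStep hq hq₂ hq' hq₂'
    have e' := equiv_of_mem_prunedStep hr₂ hr hr₂' hr'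
    rcases h with h | ⟨h, i⟩
    · exact Or.inl (PreorderedSubset.lt_of_le_of_lt e.1
        (PreorderedSubset.lt_of_lt_of_le h e'.1))
    · exact Or.inr ⟨⟨S.trans _ _ _ (S.trans _ _ _ e.1 h.1) e'.1,
          S.trans _ _ _ (S.trans _ _ _ e'.2 h.2) e.2⟩, i⟩
  refine ⟨rfl, fun q hq r hr q' hq' r' hr' => ?_⟩
  have k1 := key q hq r hr q' hq' r' hr'
  have k2 := key r hr q hq r' hr' q' hq'
  unfold PreorderedSubset.lt PreorderedSubset.equiv at *
  rw [k1, k2]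
  tauto

theorem isSubsetSuccessor_iff [Finite Q] :
    A.IsSubsetSuccessor σ S T ↔ T = A.subsetSucc σ S :=
  ⟨fun h => h.unique (isSubsetSuccessor_subsetSucc A σ S),
    fun h => h ▸ isSubsetSuccessor_subsetSucc A σ S⟩

/-! ### The ranking of a preordered subset -/

theorem classesAbove_antitone [Finite Q] {q r : Q} (h : S.le q r) :
    A.classesAbove S r ≤ A.classesAbove S q := by
  refine Set.ncard_le_ncard ?_ (Set.toFinite _)
  rintro c ⟨v, hv, hF, hlt, rfl⟩
  exact ⟨v, hv, hF, PreorderedSubset.lt_of_le_of_lt h hlt, rfl⟩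

theorem class_notMem_of_lt {q v : Q} (h : S.lt q v) :
    {x | S.equiv x v} ∉
      {c : Set Q | ∃ u, u ∈ S.carrier ∧ u ∉ A.acc ∧ S.lt v u ∧ c = {x | S.equiv x u}} := by
  rintro ⟨u, -, -, hlt, he⟩
  have hv : v ∈ {x | S.equiv x v} :=
    ⟨PreorderedSubset.refl (S.mem_of_le _ _ h.1).2, PreorderedSubset.refl (S.mem_of_le _ _ h.1).2⟩
  rw [he] at hv
  exact hlt.2 hv.2

/-- The class of r is counted for q but not for r itself; this needs r outside F. -/
theorem classesAbove_lt [Finite Q] {q r : Q} (h : S.lt q r) (hr : r ∉ A.acc) :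
    A.classesAbove S r < A.classesAbove S q := by
  refine Set.ncard_lt_ncard ⟨?_, fun hsub => ?_⟩ (Set.toFinite _)
  · rintro c ⟨v, hv, hF, hlt, rfl⟩
    exact ⟨v, hv, hF, PreorderedSubset.lt_of_le_of_lt h.1 hlt, rfl⟩
  · exact class_notMem_of_lt (A := A) h
      (hsub ⟨r, (S.mem_of_le _ _ h.1).2, hr, h, rfl⟩)

/-- Moving from q to a least non-F state above it lowers the count by exactly one, so every smaller
value is met on the way up. -/
theorem exists_classesAbove_eq [Finite Q] {q : Q} {j : ℕ} (h : j < A.classesAbove S q) :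
    ∃ v ∈ S.carrier, v ∉ A.acc ∧ S.lt q v ∧ A.classesAbove S v = j := by
  induction hb : A.classesAbove S q using Nat.strong_induction_on generalizing q with
  | _ b ih =>
  have hne : {v | v ∈ S.carrier ∧ v ∉ A.acc ∧ S.lt q v}.Nonempty := by
    rw [Set.nonempty_iff_ne_empty]
    intro he
    have : {c : Set Q | ∃ v, v ∈ S.carrier ∧ v ∉ A.acc ∧ S.lt q v ∧ c = {x | S.equiv x v}} = ∅ := by
      refine Set.eq_empty_iff_forall_notMem.2 ?_
      rintro c ⟨v, hv, hF, hlt, -⟩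
      exact Set.eq_empty_iff_forall_notMem.1 he v ⟨hv, hF, hlt⟩
    rw [classesAbove, this, Set.ncard_empty] at h
    omega
  obtain ⟨v, ⟨hv, hF, hlt⟩, hmin⟩ := PreorderedSubset.exists_least (S := S) (fun _ h => h.1) hne
  have hins : {c : Set Q | ∃ u, u ∈ S.carrier ∧ u ∉ A.acc ∧ S.lt q u ∧ c = {x | S.equiv x u}} =
      insert {x | S.equiv x v}
        {c : Set Q | ∃ u, u ∈ S.carrier ∧ u ∉ A.acc ∧ S.lt v u ∧ c = {x | S.equiv x u}} := by
    ext c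
    constructor
    · rintro ⟨u, hu, huF, hqu, rfl⟩
      by_cases hvu : S.le u v
      · refine Or.inl (Set.ext fun x => ?_)
        have := hmin u ⟨hu, huF, hqu⟩
        exact ⟨fun hx => ⟨S.trans _ _ _ hx.1 hvu, S.trans _ _ _ this hx.2⟩,
          fun hx => ⟨S.trans _ _ _ hx.1 this, S.trans _ _ _ hvu hx.2⟩⟩
      · exact Or.inr ⟨u, hu, huF, PreorderedSubset.lt_of_not_le hu hv hvu, rfl⟩
    · rintro (rfl | ⟨u, hu, huF, hvu, rfl⟩)
      · exact ⟨v, hv, hF, hlt, rfl⟩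
      · exact ⟨u, hu, huF, PreorderedSubset.lt_of_le_of_lt hlt.1 hvu, rfl⟩
  have hcard : A.classesAbove S q = A.classesAbove S v + 1 := by
    rw [classesAbove, hins, Set.ncard_insert_of_notMem (class_notMem_of_lt hlt) (Set.toFinite _)]
    rfl
  rcases Nat.lt_or_ge j (A.classesAbove S v) with hj | hj
  · obtain ⟨u, hu, huF, hvu, huj⟩ := ih _ (by omega) hj rfl
    exact ⟨u, hu, huF, PreorderedSubset.lt_of_le_of_lt hlt.1 hvu, huj⟩
  · exact ⟨v, hv, hF, hlt, by omega⟩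

theorem toRank_of_notMem {q : Q} (h : q ∉ S.carrier) : A.toRank S q = none := if_pos h

theorem toRank_of_mem_acc {q : Q} (h : q ∈ S.carrier) (hF : q ∈ A.acc) :
    A.toRank S q = some (2 * A.classesAbove S q) := by simp [toRank, h, hF]

theorem toRank_of_notMem_acc {q : Q} (h : q ∈ S.carrier) (hF : q ∉ A.acc) :
    A.toRank S q = some (2 * A.classesAbove S q + 1) := by simp [toRank, h, hF]

theorem mem_carrier_of_toRank {q : Q} {r : ℕ} (h : A.toRank S q = some r) : q ∈ S.carrier := by
  by_contra hq
  simp [toRank_of_notMem hq] at h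

theorem isTight_toRank [Finite Q] (A : NBW α Q) (S : PreorderedSubset Q) :
    IsTight (A.toRank S) := by
  rintro q r hqr i hi ⟨j, rfl⟩
  have hq := mem_carrier_of_toRank hqr
  by_cases hj : j < A.classesAbove S q
  · obtain ⟨v, hv, hF, -, rfl⟩ := exists_classesAbove_eq hj
    exact ⟨v, toRank_of_notMem_acc hv hF⟩
  · by_cases hF : q ∈ A.acc
    · rw [toRank_of_mem_acc hq hF, Option.some.injEq] at hqr
      omega
    · refine ⟨q, ?_⟩
      rw [toRank_of_notMem_acc hq hF, Option.some.injEq] at hqr ⊢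
      omega

theorem even_of_toRank_eq {q : Q} {r : ℕ} (h : A.toRank S q = some r) (hF : q ∈ A.acc) :
    Even r := by
  rw [toRank_of_mem_acc (mem_carrier_of_toRank h) hF, Option.some.injEq] at h
  exact ⟨A.classesAbove S q, by omega⟩

/-- A tight function that is even on the accepting states is a bounded level ranking. -/
theorem isLevelRanking_of_isTight [Finite Q] {f : Q → Option ℕ} (ht : IsTight f)
    (he : ∀ q r, f q = some r → q ∈ A.acc → Even r) : A.IsLevelRanking A.rankBound f :=
  fun q r h => ⟨ht.rank_le (fun q r h ho hF => Nat.not_even_iff_odd.2 ho (he q r h hF)) h, he q r h⟩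

/-- The tight level ranking of a preordered subset. -/
noncomputable def toTightRanking [Finite Q] (A : NBW α Q) (S : PreorderedSubset Q) :
    A.TightRanking :=
  ⟨A.toRank S, isLevelRanking_of_isTight (isTight_toRank A S) fun _ _ => even_of_toRank_eq,
    isTight_toRank A S⟩

/-! ### Tightening -/

/-- The number of odd ranks below `r` that are in use. -/
noncomputable def oddRanksBelow (f : Q → Option ℕ) (r : ℕ) : ℕ :=
  {i | Odd i ∧ i < r ∧ ∃ q', f q' = some i}.ncard

open Classical in
/-- The rank that replaces the rank `r` in a tightened ranking. -/
noncomputable def tightenRank (f : Q → Option ℕ) (r : ℕ) : ℕ :=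
  if Even r then 2 * oddRanksBelow f r else 2 * oddRanksBelow f r + 1

theorem tighten_eq (f : Q → Option ℕ) (q : Q) : tighten f q = (f q).map (tightenRank f) := rfl

theorem tighten_eq_some {f : Q → Option ℕ} {q : Q} {t : ℕ} :
    tighten f q = some t ↔ ∃ r, f q = some r ∧ tightenRank f r = t := by
  rw [tighten_eq, Option.map_eq_some_iff]

theorem oddRanksBelow_succ_of_used {f : Q → Option ℕ} {r : ℕ} (ho : Odd r)
    (hr : ∃ q, f q = some r) : oddRanksBelow f (r + 1) = oddRanksBelow f r + 1 := by
  have : {i | Odd i ∧ i < r + 1 ∧ ∃ q', f q' = some i} =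
      insert r {i | Odd i ∧ i < r ∧ ∃ q', f q' = some i} := by
    ext i
    constructor
    · rintro ⟨h1, h2, h3⟩
      rcases Nat.lt_succ_iff_lt_or_eq.1 h2 with h | h
      · exact Or.inr ⟨h1, h, h3⟩
      · exact Or.inl h
    · rintro (rfl | ⟨h1, h2, h3⟩)
      · exact ⟨ho, i.lt_succ_self, hr⟩
      · exact ⟨h1, h2.trans r.lt_succ_self, h3⟩
  rw [oddRanksBelow, this, Set.ncard_insert_of_notMem (fun h => lt_irrefl _ h.2.1)
    ((Set.finite_lt_nat r).subset fun _ h => h.2.1)]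
  rfl

theorem oddRanksBelow_succ_of_not {f : Q → Option ℕ} {r : ℕ}
    (h : ¬ (Odd r ∧ ∃ q, f q = some r)) : oddRanksBelow f (r + 1) = oddRanksBelow f r := by
  refine congrArg Set.ncard (Set.ext fun i => ⟨?_, fun h => ⟨h.1, by have := h.2.1; omega, h.2.2⟩⟩)
  rintro ⟨h1, h2, h3⟩
  refine ⟨h1, lt_of_le_of_ne (Nat.lt_succ_iff.1 h2) ?_, h3⟩
  rintro rfl
  exact h ⟨h1, h3⟩

theorem oddRanksBelow_zero (f : Q → Option ℕ) : oddRanksBelow f 0 = 0 := by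
  simp [oddRanksBelow]

theorem oddRanksBelow_mono (f : Q → Option ℕ) : Monotone (oddRanksBelow f) :=
  monotone_nat_of_le_succ fun r => by
    by_cases h : Odd r ∧ ∃ q, f q = some r
    · rw [oddRanksBelow_succ_of_used h.1 h.2]; omega
    · rw [oddRanksBelow_succ_of_not h]

theorem two_mul_oddRanksBelow_le (f : Q → Option ℕ) (r : ℕ) : 2 * oddRanksBelow f r ≤ r := by
  induction r with
  | zero => simp [oddRanksBelow_zero]
  | succ r ih =>
    by_cases h : Odd r ∧ ∃ q, f q = some r
    · rw [oddRanksBelow_succ_of_used h.1 h.2]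
      have := Nat.odd_iff.1 h.1
      omega
    · rw [oddRanksBelow_succ_of_not h]; omega

/-- The count grows in steps of one, and only at odd ranks in use, so each smaller value is left at
such a rank. -/
theorem exists_oddRanksBelow_eq {f : Q → Option ℕ} {r j : ℕ} (h : j < oddRanksBelow f r) :
    ∃ i q, Odd i ∧ f q = some i ∧ oddRanksBelow f i = j := by
  induction r with
  | zero => simp [oddRanksBelow_zero] at h
  | succ r ih =>
    by_cases hr : Odd r ∧ ∃ q, f q = some r
    · rw [oddRanksBelow_succ_of_used hr.1 hr.2] at h
      rcases Nat.lt_succ_iff_lt_or_eq.1 h with h | h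
      · exact ih h
      · obtain ⟨ho, q, hq⟩ := hr
        exact ⟨r, q, ho, hq, h.symm⟩
    · exact ih (by rwa [oddRanksBelow_succ_of_not hr] at h)

theorem even_tightenRank {f : Q → Option ℕ} {r : ℕ} : Even (tightenRank f r) ↔ Even r := by
  unfold tightenRank
  split_ifs with h
  · simp [h]
  · simp [h, parity_simps]

theorem tightenRank_le (f : Q → Option ℕ) (r : ℕ) : tightenRank f r ≤ r := by
  have := two_mul_oddRanksBelow_le f r
  unfold tightenRank
  split_ifs with h
  · exact this
  · rw [Nat.not_even_iff] at h
    omega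

/-- The smaller rank must be in use: an unused odd r could map to 2γ + 1 while r + 1 maps to 2γ. -/
theorem tightenRank_mono {f : Q → Option ℕ} {r s : ℕ} (hr : ∃ q, f q = some r) (h : r ≤ s) :
    tightenRank f r ≤ tightenRank f s := by
  have h1 := oddRanksBelow_mono f h
  rcases h.eq_or_lt with rfl | hlt
  · exact le_rfl
  · by_cases he : Even r
    · unfold tightenRank
      split_ifs <;> omega
    · have h2 := oddRanksBelow_succ_of_used (Nat.not_even_iff_odd.1 he) hr
      have h3 := oddRanksBelow_mono f (Nat.succ_le_of_lt hlt)
      rw [Nat.succ_eq_add_one] at h3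
      unfold tightenRank
      split_ifs <;> omega

theorem tightenRank_lt_of_odd {f : Q → Option ℕ} {r s : ℕ} (hr : ∃ q, f q = some r)
    (ho : Odd r) (h : r < s) : tightenRank f r < tightenRank f s := by
  have h2 := oddRanksBelow_succ_of_used ho hr
  have h3 := oddRanksBelow_mono f (Nat.succ_le_of_lt h)
  rw [Nat.succ_eq_add_one] at h3
  unfold tightenRank
  rw [if_neg (Nat.not_even_iff_odd.2 ho)]
  split_ifs <;> omega

theorem isTight_tighten (f : Q → Option ℕ) : IsTight (tighten f) := by
  rintro q t ht i hi ⟨j, rfl⟩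
  obtain ⟨r, hr, rfl⟩ := tighten_eq_some.1 ht
  by_cases hj : j < oddRanksBelow f r
  · obtain ⟨i, q', ho, hq', rfl⟩ := exists_oddRanksBelow_eq hj
    exact ⟨q', tighten_eq_some.2 ⟨i, hq', if_neg (Nat.not_even_iff_odd.2 ho)⟩⟩
  · refine ⟨q, tighten_eq_some.2 ⟨r, hr, ?_⟩⟩
    unfold tightenRank at hi ⊢
    split_ifs at hi ⊢ <;> omega

/-! ### Successors of level rankings -/

theorem inheritRank_eq_none_iff {f : Q → Option ℕ} {q' : Q} :
    A.inheritRank σ f q' = none ↔ ∀ q, q' ∈ A.step q σ → f q = none := by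
  have : A.predRanks σ f q' = ∅ ↔ ∀ q, q' ∈ A.step q σ → f q = none := by
    simp only [predRanks, Set.eq_empty_iff_forall_notMem, Set.mem_ofPred_eq, not_exists, not_and]
    constructor
    · intro h q hq
      cases hf : f q with
      | none => rfl
      | some r => exact absurd hf (h r q hq)
    · intro h r q hq
      simp [h q hq]
  rw [← this]
  unfold inheritRank
  split_ifs with h1 <;> simp [h1]

theorem even_of_inheritRank_eq {f : Q → Option ℕ} {q : Q} {r : ℕ}
    (h : A.inheritRank σ f q = some r) (hF : q ∈ A.acc) : Even r := by
  unfold inheritRank at h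
  rw [if_pos hF] at h
  split_ifs at h
  rw [Option.some.injEq] at h
  subst h
  exact even_two_mul _

/-- The successor of a tight level ranking. -/
noncomputable def tightSucc [Finite Q] (A : NBW α Q) (σ : α) (f : Q → Option ℕ) :
    A.TightRanking :=
  ⟨A.rankSuccessor σ f, isLevelRanking_of_isTight (isTight_tighten _) (by
    intro q t ht hF
    obtain ⟨r, hr, rfl⟩ := tighten_eq_some.1 ht
    exact even_tightenRank.2 (even_of_inheritRank_eq hr hF)), isTight_tighten _⟩

end NBW

namespace NBW

variable {α : Type u} {Q : Type v} {A : NBW α Q} {σ : α}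

/-! ### The transitions of the complementary automaton -/

instance finite_tightRanking [Finite Q] (A : NBW α Q) : Finite A.TightRanking :=
  ((finite_setOf_rank_le A.rankBound).subset fun _ hf q r h => (hf.1 q r h).1 :
    {f : Q → Option ℕ | A.IsLevelRanking A.rankBound f ∧ IsTight f}.Finite).to_subtype

theorem mem_retroStep_inl [Finite Q] {S : PreorderedSubset Q} {t : A.RetroState} :
    t ∈ A.retro.step (.inl S) σ ↔ t = .inl (A.subsetSucc σ S) ∨
      t = .inr (A.toTightRanking (A.subsetSucc σ S), ∅) := by
  constructor
  · rintro ⟨S', hS', h⟩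
    obtain rfl := isSubsetSuccessor_iff.1 hS'
    refine h.imp_right ?_
    rintro ⟨f, hf, rfl⟩
    rw [show f = A.toTightRanking (A.subsetSucc σ S) from Subtype.ext hf]
  · intro h
    exact ⟨_, isSubsetSuccessor_subsetSucc A σ S, h.imp_right fun h => ⟨_, rfl, h⟩⟩

theorem mem_retroStep_inr [Finite Q] {f : A.TightRanking} {O : Set Q} {t : A.RetroState} :
    t ∈ A.retro.step (.inr (f, O)) σ ↔ t = .inr (A.tightSucc σ f.1,
      A.nextObligation σ O (A.tightSucc σ f.1).1) := by
  constructor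
  · rintro ⟨f', hf', rfl⟩
    rw [show f' = A.tightSucc σ f.1 from Subtype.ext hf']
  · rintro rfl
    exact ⟨A.tightSucc σ f.1, rfl, rfl⟩

theorem encard_retroStep_le_two [Finite Q] (s : A.RetroState) (σ : α) :
    (A.retro.step s σ).encard ≤ 2 := by
  rcases s with S | ⟨f, O⟩
  · rw [show A.retro.step (.inl S) σ = {.inl (A.subsetSucc σ S),
      .inr (A.toTightRanking (A.subsetSucc σ S), ∅)} from Set.ext fun _ => mem_retroStep_inl]
    refine (Set.encard_insert_le _ _).trans ?_
    rw [Set.encard_singleton, one_add_one_eq_two]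
  · rw [show A.retro.step (.inr (f, O)) σ = {_} from Set.ext fun _ => mem_retroStep_inr,
      Set.encard_singleton]
    exact one_le_two

theorem deterministicInTheLimit_retro [Finite Q] (A : NBW α Q) :
    A.retro.DeterministicInTheLimit := by
  rintro _ ⟨f, rfl⟩ t ht σ
  have hr : ∃ g O, t = .inr (g, O) := by
    induction ht with
    | refl => exact ⟨_, _, rfl⟩
    | tail _ hstep ih =>
      obtain ⟨g, O, rfl⟩ := ih
      obtain ⟨σ, h⟩ := hstep
      exact ⟨_, _, mem_retroStep_inr.1 h⟩
  obtain ⟨g, O, rfl⟩ := hr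
  rw [show A.retro.step (.inr (g, O)) σ = {_} from Set.ext fun _ => mem_retroStep_inr,
    Set.encard_singleton]

theorem rankSuccessor_ne_none {f : Q → Option ℕ} {q q' : Q} (h : q' ∈ A.step q σ)
    (hq : f q ≠ none) : A.rankSuccessor σ f q' ≠ none := by
  rw [rankSuccessor, tighten_eq, Ne, Option.map_eq_none_iff, inheritRank_eq_none_iff]
  exact fun h' => hq (h' q h)

/-- Successors of ranked states are ranked, so those whose rank is not odd have even rank. -/
theorem nextObligation_subset {f : Q → Option ℕ} {O : Set Q} (hO : O ⊆ evenStates f) :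
    A.nextObligation σ O (A.rankSuccessor σ f) ⊆ evenStates (A.rankSuccessor σ f) := by
  unfold nextObligation
  split_ifs
  · exact subset_rfl
  · rintro q' ⟨h, hodd⟩
    obtain ⟨q, hq, hstep⟩ := mem_stepSet.1 h
    obtain ⟨r, hr, -⟩ := hO hq
    obtain ⟨t, ht⟩ := Option.ne_none_iff_exists'.1
      (rankSuccessor_ne_none (f := f) hstep (by simp [hr]))
    exact ⟨t, ht, by_contra fun h => hodd ⟨t, ht, Nat.not_even_iff_odd.1 h⟩⟩

theorem reachable_retro_subset [Finite Q] (A : NBW α Q) :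
    A.retro.reachable ⊆ A.evenObligationStates := by
  rintro t ⟨s, rfl, ht⟩
  induction ht with
  | refl => exact fun f O h => by simp at h
  | @tail b c _ hstep ih =>
    obtain ⟨σ, h⟩ := hstep
    rintro f O rfl
    rcases b with S | ⟨g, P⟩
    · rcases mem_retroStep_inl.1 h with h | h
      · simp at h
      · simp only [Sum.inr.injEq, Prod.mk.injEq] at h
        rw [h.2]
        exact Set.empty_subset _
    · have h := mem_retroStep_inr.1 h
      simp only [Sum.inr.injEq, Prod.mk.injEq] at h
      obtain ⟨rfl, rfl⟩ := h
      exact nextObligation_subset (ih g P rfl)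

/-! ### The runs of the complementary automaton -/

/-- The first-stage states on the word `w`. -/
def subsetSeq [Finite Q] (A : NBW α Q) (w : ℕ → α) : ℕ → PreorderedSubset Q
  | 0 => A.initialSubset
  | i + 1 => A.subsetSucc (w i) (A.subsetSeq w i)

/-- `(f i, O i)`, for `i > k`, are the second-stage states on the word `w`, when the stage changes
after position `k`. -/
structure IsRankRun [Finite Q] (A : NBW α Q) (w : ℕ → α) (k : ℕ) (f : ℕ → A.TightRanking)
    (O : ℕ → Set Q) : Prop where
  rank_start : f (k + 1) = A.toTightRanking (A.subsetSeq w (k + 1))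
  obligation_start : O (k + 1) = ∅
  rank_succ : ∀ i, k < i → f (i + 1) = A.tightSucc (w i) (f i).1
  obligation_succ : ∀ i, k < i → O (i + 1) = A.nextObligation (w i) (O i) (f (i + 1)).1

/-- The second-stage states by their distance from the change of stage. -/
noncomputable def rankSeq [Finite Q] (A : NBW α Q) (w : ℕ → α) (k : ℕ) :
    ℕ → A.TightRanking × Set Q
  | 0 => (A.toTightRanking (A.subsetSeq w (k + 1)), ∅)
  | j + 1 => (A.tightSucc (w (k + 1 + j)) (A.rankSeq w k j).1.1,
      A.nextObligation (w (k + 1 + j)) (A.rankSeq w k j).2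
        (A.tightSucc (w (k + 1 + j)) (A.rankSeq w k j).1.1).1)

theorem exists_isRankRun [Finite Q] (A : NBW α Q) (w : ℕ → α) (k : ℕ) :
    ∃ f O, A.IsRankRun w k f O := by
  refine ⟨fun i => (A.rankSeq w k (i - (k + 1))).1, fun i => (A.rankSeq w k (i - (k + 1))).2,
    by simp [rankSeq], by simp [rankSeq], fun i hi => ?_, fun i hi => ?_⟩ <;>
  · obtain ⟨j, rfl⟩ : ∃ j, i = k + 1 + j := ⟨i - (k + 1), by omega⟩
    have h1 : k + 1 + j + 1 - (k + 1) = j + 1 := by omega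
    have h2 : k + 1 + j - (k + 1) = j := by omega
    simp only [h1, h2, rankSeq]

theorem exists_acceptingRun_iff [Finite Q] {w : ℕ → α} {k : ℕ} :
    (∃ p, A.retro.IsAcceptingRun w p ∧ ∀ i, (p i).isLeft = true ↔ i ≤ k) ↔
      ∃ f O, A.IsRankRun w k f O ∧ ∃ᶠ i in atTop, O i = ∅ := by
  constructor
  · rintro ⟨p, ⟨⟨h0, hstep⟩, hacc⟩, hleft⟩
    have hS : ∀ i ≤ k, p i = .inl (A.subsetSeq w i) := fun i => by
      induction i with
      | zero => exact fun _ => h0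
      | succ i ih =>
        intro hi
        have h := hstep i
        rw [ih (by omega), mem_retroStep_inl] at h
        rcases h with h | h
        · exact h
        · have := (hleft (i + 1)).2 hi
          simp [h] at this
    have hR : ∀ i, ∃ s : A.TightRanking × Set Q, k < i → p i = .inr s := fun i => by
      rcases hp : p i with S | s
      · refine ⟨A.rankSeq w k 0, fun hi => ?_⟩
        have := (hleft i).1 (by simp [hp])
        omega
      · exact ⟨s, fun _ => rfl⟩
    choose s hs using hR
    have hstart : s (k + 1) = (A.toTightRanking (A.subsetSeq w (k + 1)), ∅) := by
      have h := hstep k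
      rw [hS k le_rfl, hs (k + 1) (by omega), mem_retroStep_inl] at h
      simp only [reduceCtorEq, Sum.inr.injEq, false_or] at h
      exact h
    have hsucc : ∀ i, k < i → s (i + 1) = (A.tightSucc (w i) (s i).1.1,
        A.nextObligation (w i) (s i).2 (A.tightSucc (w i) (s i).1.1).1) := fun i hi => by
      have h := hstep i
      rw [hs i hi, hs (i + 1) (by omega), mem_retroStep_inr] at h
      simpa using h
    refine ⟨fun i => (s i).1, fun i => (s i).2, ⟨by simp [hstart], by simp [hstart],
      fun i hi => by simp [hsucc i hi], fun i hi => by simp [hsucc i hi]⟩, ?_⟩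
    refine (hacc.and_eventually (eventually_gt_atTop k)).mono ?_
    rintro i ⟨⟨f, hf⟩, hi⟩
    rw [hs i hi, Sum.inr.injEq] at hf
    simp [hf]
  · rintro ⟨f, O, h, hO⟩
    refine ⟨fun i => if i ≤ k then .inl (A.subsetSeq w i) else .inr (f i, O i),
      ⟨⟨by simp [subsetSeq, retro], fun i => ?_⟩, ?_⟩, fun i => ?_⟩
    · beta_reduce
      rcases lt_trichotomy i k with hi | rfl | hi
      · rw [if_pos hi.le, if_pos (by omega), mem_retroStep_inl]
        exact Or.inl rfl
      · rw [if_pos le_rfl, if_neg (by omega), mem_retroStep_inl, h.rank_start, h.obligation_start]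
        exact Or.inr rfl
      · rw [if_neg (by omega), if_neg (by omega), mem_retroStep_inr, h.obligation_succ i hi,
          h.rank_succ i hi]
    · refine (hO.and_eventually (eventually_gt_atTop k)).mono ?_
      rintro i ⟨hO, hi⟩
      beta_reduce
      rw [if_neg (by omega), hO]
      exact ⟨f i, rfl⟩
    · by_cases hi : i ≤ k <;> simp [hi]

/-- An accepting run must enter the second stage and can never leave it. The entry position is
positive because the initial state is in the first stage; k is its predecessor. -/
theorem mem_language_retro_iff [Finite Q] {w : ℕ → α} :
    w ∈ A.retro.language ↔
      ∃ k, ∃ p, A.retro.IsAcceptingRun w p ∧ ∀ i, (p i).isLeft = true ↔ i ≤ k := by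
  classical
  refine ⟨?_, fun ⟨k, p, h, _⟩ => ⟨p, h⟩⟩
  rintro ⟨p, ⟨⟨h0, hstep⟩, hacc⟩⟩
  have hex : ∃ i, (p i).isRight = true := by
    obtain ⟨i, f, hf⟩ := hacc.exists
    exact ⟨i, by simp [hf]⟩
  have hpers : ∀ i j, i ≤ j → (p i).isRight = true → (p j).isRight = true := fun i j hij hi => by
    induction j, hij using Nat.le_induction with
    | base => exact hi
    | succ j _ ih =>
      obtain ⟨⟨f, O⟩, hs⟩ := Sum.isRight_iff.1 ih
      have h := hstep j
      rw [hs, mem_retroStep_inr] at h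
      simp [h]
  have hpos : Nat.find hex ≠ 0 := fun h => by
    have := Nat.find_spec hex
    rw [h, show p 0 = .inl A.initialSubset from h0] at this
    simp at this
  refine ⟨Nat.find hex - 1, p, ⟨⟨h0, hstep⟩, hacc⟩, fun i => ?_⟩
  rw [← Sum.not_isRight]
  constructor
  · intro h
    by_contra hi
    exact h (hpers _ i (by omega) (Nat.find_spec hex))
  · intro h
    exact Nat.find_min hex (by omega)

end NBW

namespace NBW

variable {α : Type u} {Q : Type v} {A : NBW α Q} {w : ℕ → α}

/-! ### Profiles and the preorders of the first stage -/

/-- Equal lengths rule out proper prefixes, so the appended bits only break ties. -/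
theorem append_singleton_lt_iff {l l' : List Bool} (h : l.length = l'.length) {a b : Bool} :
    l ++ [a] < l' ++ [b] ↔ l < l' ∨ l = l' ∧ a < b := by
  induction l generalizing l' with
  | nil =>
    obtain rfl := List.length_eq_zero_iff.1 h.symm
    simp [List.cons_lt_cons_iff]
  | cons x l ih =>
    cases l' with
    | nil => simp at h
    | cons y l' =>
      simp only [List.length_cons, add_left_inj] at h
      simp only [List.cons_append, List.cons_lt_cons_iff, ih h, List.cons.injEq]
      tauto

theorem append_singleton_le_iff {l l' : List Bool} (h : l.length = l'.length) {a b : Bool} :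
    l ++ [a] ≤ l' ++ [b] ↔ l < l' ∨ l = l' ∧ a ≤ b := by
  rw [← not_lt, append_singleton_lt_iff h.symm, ← not_lt (a := b)]
  rcases lt_trichotomy l l' with h | h | h
  · simp [h, h.not_gt, h.ne']
  · simp [h]
  · simp [h, h.not_gt, h.ne']

theorem length_pathProfile (A : NBW α Q) (i : ℕ) (b : ℕ → Q) :
    (A.pathProfile i b).length = i + 1 := by simp [pathProfile]

open Classical in
theorem pathProfile_succ (A : NBW α Q) (i : ℕ) (b : ℕ → Q) :
    A.pathProfile (i + 1) b = A.pathProfile i b ++ [decide (b (i + 1) ∈ A.acc)] := by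
  simp [pathProfile, List.range_succ]

theorem pathProfile_congr (A : NBW α Q) {i : ℕ} {b b' : ℕ → Q} (h : ∀ j ≤ i, b j = b' j) :
    A.pathProfile i b = A.pathProfile i b' := by
  unfold pathProfile
  refine List.map_congr_left fun j hj => ?_
  rw [h j (by rw [List.mem_range] at hj; omega)]

theorem IsInitialPath.extend {i : ℕ} {b : ℕ → Q} (h : A.IsInitialPath w i b) {q : Q}
    (hq : q ∈ A.step (b i) (w i)) :
    A.IsInitialPath w (i + 1) (fun j => if j ≤ i then b j else q) := by
  refine ⟨by simpa using h.1, fun j hj => ?_⟩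
  rcases Nat.lt_succ_iff_lt_or_eq.1 hj with hj | rfl
  · have h1 : j + 1 ≤ i := hj
    simpa [h1, hj.le] using h.2 j hj
  · simpa using hq

theorem IsInitialPath.mono {i j : ℕ} {b : ℕ → Q} (h : A.IsInitialPath w i b) (hj : j ≤ i) :
    A.IsInitialPath w j b := ⟨h.1, fun l hl => h.2 l (by omega)⟩

theorem mem_dagNodes {q : Q} {i : ℕ} :
    (q, i) ∈ A.dagNodes w ↔ ∃ b, A.IsInitialPath w i b ∧ b i = q := Iff.rfl

theorem mem_dagNodes_zero {q : Q} : (q, 0) ∈ A.dagNodes w ↔ q ∈ A.init := by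
  rw [mem_dagNodes]
  constructor
  · rintro ⟨b, hb, rfl⟩
    exact hb.1
  · intro h
    exact ⟨fun _ => q, ⟨h, fun j hj => by simp at hj⟩, rfl⟩

theorem mem_dagNodes_succ {q : Q} {i : ℕ} :
    (q, i + 1) ∈ A.dagNodes w ↔ ∃ p, (p, i) ∈ A.dagNodes w ∧ q ∈ A.step p (w i) := by
  simp only [mem_dagNodes]
  constructor
  · rintro ⟨b, hb, rfl⟩
    exact ⟨b i, ⟨b, hb.mono (Nat.le_succ i), rfl⟩, hb.2 i i.lt_succ_self⟩
  · rintro ⟨p, ⟨b, hb, rfl⟩, hq⟩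
    exact ⟨_, hb.extend hq, by simp⟩

variable [Finite Q]

theorem mem_carrier_subsetSeq {q : Q} {i : ℕ} :
    q ∈ (A.subsetSeq w i).carrier ↔ (q, i) ∈ A.dagNodes w := by
  induction i generalizing q with
  | zero => exact mem_dagNodes_zero.symm
  | succ i ih =>
    rw [mem_dagNodes_succ]
    refine mem_stepSet.trans ?_
    simp only [ih]

theorem isSubsetSuccessor_subsetSeq (A : NBW α Q) (w : ℕ → α) (i : ℕ) :
    A.IsSubsetSuccessor (w i) (A.subsetSeq w i) (A.subsetSeq w (i + 1)) :=
  isSubsetSuccessor_subsetSucc A (w i) _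

/-- Every node has a profile, and the preorders of the first stage compare profiles. -/
theorem exists_nodeProfile (A : NBW α Q) (w : ℕ → α) (i : ℕ) :
    ∃ H : Q → List Bool, (∀ q ∈ (A.subsetSeq w i).carrier, A.IsNodeProfile w (q, i) (H q)) ∧
      ∀ q ∈ (A.subsetSeq w i).carrier, ∀ r ∈ (A.subsetSeq w i).carrier,
        ((A.subsetSeq w i).le q r ↔ H q ≤ H r) := by
  classical
  induction i with
  | zero =>
    refine ⟨fun q => [decide (q ∈ A.acc)], fun q hq => ⟨⟨fun _ => q, ⟨hq, by simp⟩, rfl,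
      by simp [pathProfile]⟩, ?_⟩, fun q hq r hr => ?_⟩
    · rintro _ ⟨b, hb, hbq, rfl⟩
      simp only at hbq
      simp [pathProfile, hbq]
    · change q ∈ A.init ∧ r ∈ A.init ∧ (q ∉ A.acc ∨ r ∈ A.acc) ↔ _
      have hq : q ∈ A.init := hq
      have hr : r ∈ A.init := hr
      have := append_singleton_le_iff (l := []) (l' := []) rfl (a := decide (q ∈ A.acc))
        (b := decide (r ∈ A.acc))
      simp only [List.nil_append, lt_irrefl, true_and, false_or] at this
      rw [this]
      by_cases h1 : q ∈ A.acc <;> by_cases h2 : r ∈ A.acc <;> simp [h1, h2, hq, hr]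
  | succ i ih =>
    obtain ⟨H, hH, hle⟩ := ih
    have hlen : ∀ q ∈ (A.subsetSeq w i).carrier, (H q).length = i + 1 := fun q hq => by
      obtain ⟨b, -, -, h⟩ := (hH q hq).1
      rw [h]
      exact length_pathProfile A i b
    have hpar : ∀ q, ∃ p, q ∈ (A.subsetSeq w (i + 1)).carrier →
        p ∈ (A.subsetSeq w i).carrier ∧ q ∈ A.prunedStep (A.subsetSeq w i) p (w i) := fun q => by
      by_cases hq : q ∈ (A.subsetSeq w (i + 1)).carrier
      · obtain ⟨p, hp⟩ := exists_mem_prunedStep hq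
        exact ⟨p, fun _ => hp⟩
      · exact ⟨q, fun h => absurd h hq⟩
    -- `P q` is a pruned parent of q; the profile of q is that of `P q` followed by the bit of q.
    choose P hP using hpar
    refine ⟨fun q => H (P q) ++ [decide (q ∈ A.acc)], fun q hq => ?_, fun q hq r hr => ?_⟩
    · obtain ⟨hp, hstep, hmax⟩ := hP q hq
      obtain ⟨⟨b, hb, hbp, hbH⟩, -⟩ := hH _ hp
      simp only at hb hbp hbH
      refine ⟨⟨_, hb.extend (hbp ▸ hstep), by simp, ?_⟩, ?_⟩
      · beta_reduce
        rw [hbH, pathProfile_succ]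
        simp only [Nat.not_succ_le_self, if_false]
        congr 1
        exact pathProfile_congr A fun j hj => by simp [hj]
      · rintro _ ⟨c, hc, hcq, rfl⟩
        simp only at hc hcq
        have hc' := hc.mono (Nat.le_succ i)
        have hci : c i ∈ (A.subsetSeq w i).carrier := mem_carrier_subsetSeq.2 ⟨c, hc', rfl⟩
        -- Any competing path has a prefix profile at most that of its last node before q, which in
        -- turn is dominated by `P q`.
        have h1 : A.pathProfile i c ≤ H (c i) := (hH _ hci).2 ⟨c, hc', rfl, rfl⟩
        have h2 : H (c i) ≤ H (P q) := (hle _ hci _ hp).1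
          (hmax _ hci (hcq ▸ hc.2 i i.lt_succ_self))
        rw [pathProfile_succ, hcq, append_singleton_le_iff
          ((length_pathProfile A i c).trans (hlen _ hp).symm)]
        exact (h1.trans h2).lt_or_eq.imp_right fun h => ⟨h, le_rfl⟩
    · obtain ⟨hp, hpq⟩ := hP q hq
      obtain ⟨hp', hpr⟩ := hP r hr
      rw [(isSubsetSuccessor_subsetSeq A w i).le_iff hp hp' hpq hpr,
        append_singleton_le_iff ((hlen _ hp).trans (hlen _ hp').symm)]
      have e1 := hle _ hp _ hp'
      have e2 := hle _ hp' _ hp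
      unfold PreorderedSubset.lt PreorderedSubset.equiv
      rw [e1, e2, ← lt_iff_le_not_ge, ← le_antisymm_iff]
      refine or_congr_right (and_congr_right fun _ => ?_)
      by_cases h1 : q ∈ A.acc <;> by_cases h2 : r ∈ A.acc <;> simp [h1, h2]

theorem profileLT_iff {q r : Q} {i : ℕ} (hq : q ∈ (A.subsetSeq w i).carrier)
    (hr : r ∈ (A.subsetSeq w i).carrier) :
    A.ProfileLT w (q, i) (r, i) ↔ (A.subsetSeq w i).lt q r := by
  obtain ⟨H, hH, hle⟩ := exists_nodeProfile A w i
  have : (A.subsetSeq w i).lt q r ↔ H q < H r := by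
    unfold PreorderedSubset.lt
    rw [hle q hq r hr, hle r hr q hq, lt_iff_le_not_ge]
  rw [this]
  constructor
  · rintro ⟨h, h', h1, h2, hlt⟩
    rwa [h1.unique (hH q hq), h2.unique (hH r hr)] at hlt
  · exact fun h => ⟨_, _, hH q hq, hH r hr, h⟩

/-- This identifies G', defined through profiles, with the pruned transitions that the automaton can
compute. -/
theorem prunedEdge_iff {q r : Q} {i j : ℕ} :
    A.prunedEdge w (q, i) (r, j) ↔ j = i + 1 ∧ q ∈ (A.subsetSeq w i).carrier ∧
      r ∈ A.prunedStep (A.subsetSeq w i) q (w i) := by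
  constructor
  · rintro ⟨⟨hq, rfl, hstep⟩, hmax⟩
    rw [← mem_carrier_subsetSeq] at hq
    refine ⟨rfl, hq, hstep, fun p hp hpr => ?_⟩
    by_contra hle
    refine hmax ⟨(p, i), ⟨mem_carrier_subsetSeq.1 hp, rfl, hpr⟩, ?_⟩
    exact (profileLT_iff hq hp).2 (PreorderedSubset.lt_of_not_le hp hq hle)
  · rintro ⟨rfl, hq, hstep, hmax⟩
    refine ⟨⟨mem_carrier_subsetSeq.1 hq, rfl, hstep⟩, ?_⟩
    rintro ⟨⟨p, j⟩, ⟨hp, hj, hpr⟩, hlt⟩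
    simp only [add_left_inj] at hj hpr
    subst hj
    rw [← mem_carrier_subsetSeq] at hp
    exact ((profileLT_iff hq hp).1 hlt).2 (hmax p hp hpr)

/-- The last bit of a profile records membership in F. This is special to the preorders along a
word: a class of an arbitrary preordered subset may mix both kinds of states. -/
theorem acc_iff_of_equiv_subsetSeq {q r : Q} {i : ℕ} (h : (A.subsetSeq w i).equiv q r) :
    q ∈ A.acc ↔ r ∈ A.acc := by
  have key : ∀ q r, (A.subsetSeq w i).equiv q r → q ∈ A.acc → r ∈ A.acc := fun q r h => by
    cases i with
    | zero =>
      obtain ⟨-, -, h'⟩ := h.1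
      tauto
    | succ i =>
      obtain ⟨hq, hr⟩ := (A.subsetSeq w (i + 1)).mem_of_le _ _ h.1
      obtain ⟨p, hp, hpq⟩ := exists_mem_prunedStep hq
      obtain ⟨p', hp', hpr⟩ := exists_mem_prunedStep hr
      have hs := isSubsetSuccessor_subsetSeq A w i
      have h1 := (hs.le_iff hp hp' hpq hpr).1 h.1
      have h2 := (hs.le_iff hp' hp hpr hpq).1 h.2
      rcases h1 with h1 | h1
      · rcases h2 with h2 | h2
        · exact absurd h1.1 h2.2
        · exact absurd h2.1.1 h1.2
      · exact h1.2
  exact ⟨key q r h, key r q ⟨h.2, h.1⟩⟩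

end NBW

namespace NBW

variable {α : Type u} {Q : Type v} {A : NBW α Q} {σ : α} {S T : PreorderedSubset Q}

/-! ### Rankings that are compatible with a preorder -/

/-- The ranking `f` is defined on `S`, antitone, and injective up to equivalence on odd ranks. -/
structure RankCompatible (S : PreorderedSubset Q) (f : Q → Option ℕ) : Prop where
  mem_iff : ∀ q, q ∈ S.carrier ↔ ∃ r, f q = some r
  antitone : ∀ q r a b, S.le q r → f q = some a → f r = some b → b ≤ a
  le_of_odd : ∀ q r a, f q = some a → f r = some a → Odd a → S.le q r

/-- Unmixed classes are needed for antitonicity: equivalent states with q in F and r outside F would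
get the ranks 2β and 2β + 1. -/
theorem rankCompatible_toRank [Finite Q]
    (hS : ∀ q r, S.equiv q r → (q ∈ A.acc ↔ r ∈ A.acc)) : RankCompatible S (A.toRank S) where
  mem_iff q := by
    refine ⟨fun h => ?_, fun ⟨r, hr⟩ => mem_carrier_of_toRank hr⟩
    by_cases hF : q ∈ A.acc
    · exact ⟨_, toRank_of_mem_acc h hF⟩
    · exact ⟨_, toRank_of_notMem_acc h hF⟩
  antitone q r a b hle ha hb := by
    obtain ⟨hq, hr⟩ := S.mem_of_le _ _ hle
    have h1 := classesAbove_antitone (A := A) hle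
    by_cases hrF : r ∈ A.acc
    · rw [toRank_of_mem_acc hr hrF, Option.some.injEq] at hb
      by_cases hqF : q ∈ A.acc
      · rw [toRank_of_mem_acc hq hqF, Option.some.injEq] at ha
        omega
      · rw [toRank_of_notMem_acc hq hqF, Option.some.injEq] at ha
        omega
    · rw [toRank_of_notMem_acc hr hrF, Option.some.injEq] at hb
      by_cases hqF : q ∈ A.acc
      · rw [toRank_of_mem_acc hq hqF, Option.some.injEq] at ha
        have := classesAbove_lt (A := A) ⟨hle, fun h => hrF ((hS q r ⟨hle, h⟩).1 hqF)⟩ hrF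
        omega
      · rw [toRank_of_notMem_acc hq hqF, Option.some.injEq] at ha
        omega
  le_of_odd q r a ha hb ho := by
    have hq := mem_carrier_of_toRank ha
    have hr := mem_carrier_of_toRank hb
    have hqF : q ∉ A.acc := fun hF => Nat.not_even_iff_odd.2 ho (even_of_toRank_eq ha hF)
    have hrF : r ∉ A.acc := fun hF => Nat.not_even_iff_odd.2 ho (even_of_toRank_eq hb hF)
    rw [toRank_of_notMem_acc hq hqF, Option.some.injEq] at ha
    rw [toRank_of_notMem_acc hr hrF, Option.some.injEq] at hb
    by_contra hle
    have := classesAbove_lt (A := A) (PreorderedSubset.lt_of_not_le hq hr hle) hqF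
    omega

/-- Tightening is monotone on the ranks in use and strict above a used odd rank, so it neither
reverses ranks nor merges odd ones. -/
theorem RankCompatible.tighten {f : Q → Option ℕ} (h : RankCompatible S f) :
    RankCompatible S (tighten f) where
  mem_iff q := by
    rw [h.mem_iff]
    simp [tighten_eq_some]
  antitone q r a b hle ha hb := by
    obtain ⟨a, ha', rfl⟩ := tighten_eq_some.1 ha
    obtain ⟨b, hb', rfl⟩ := tighten_eq_some.1 hb
    exact tightenRank_mono ⟨r, hb'⟩ (h.antitone q r a b hle ha' hb')
  le_of_odd q r t ha hb ho := by
    obtain ⟨a, ha', rfl⟩ := tighten_eq_some.1 ha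
    obtain ⟨b, hb', hab⟩ := tighten_eq_some.1 hb
    have hoa : Odd a := by
      rw [← Nat.not_even_iff_odd] at ho ⊢
      rwa [even_tightenRank] at ho
    have hob : Odd b := by
      rw [← Nat.not_even_iff_odd] at ho ⊢
      rwa [← hab, even_tightenRank] at ho
    rcases lt_trichotomy a b with hlt | rfl | hlt
    · exact absurd hab (tightenRank_lt_of_odd ⟨q, ha'⟩ hoa hlt).ne'
    · exact h.le_of_odd q r a ha' hb' hoa
    · exact absurd hab (tightenRank_lt_of_odd ⟨r, hb'⟩ hob hlt).ne

open Classical in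
/-- The value of an inherited rank at a state that inherits from the rank `a`. -/
noncomputable def roundRank (A : NBW α Q) (q : Q) (a : ℕ) : ℕ :=
  if q ∈ A.acc then 2 * (a / 2) else a

theorem inheritRank_eq_of_isLeast {f : Q → Option ℕ} {q' : Q} {a : ℕ}
    (h : IsLeast (A.predRanks σ f q') a) : A.inheritRank σ f q' = some (A.roundRank q' a) := by
  have hne : A.predRanks σ f q' ≠ ∅ := Set.nonempty_iff_ne_empty.1 ⟨a, h.1⟩
  have : sInf (A.predRanks σ f q') = a := h.csInf_eq
  simp only [inheritRank, if_neg hne, this, roundRank]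
  split_ifs <;> rfl

/-- Antitonicity makes the greatest predecessor one of least rank, so the minimum is attained at a
pruned parent. -/
theorem RankCompatible.inheritRank_eq {f : Q → Option ℕ} (h : RankCompatible S f) {q q' : Q}
    {a : ℕ} (hq' : q' ∈ A.prunedStep S q σ) (ha : f q = some a) :
    A.inheritRank σ f q' = some (A.roundRank q' a) := by
  refine inheritRank_eq_of_isLeast ⟨⟨q, hq'.1, ha⟩, ?_⟩
  rintro b ⟨p, hp, hb⟩
  exact h.antitone p q b a (hq'.2 p ((h.mem_iff p).2 ⟨b, hb⟩) hp) hb ha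

theorem roundRank_le (A : NBW α Q) (q : Q) (a : ℕ) : A.roundRank q a ≤ a := by
  unfold roundRank
  split_ifs <;> omega

theorem even_roundRank {q : Q} {a : ℕ} : Even (A.roundRank q a) ↔ q ∈ A.acc ∨ Even a := by
  unfold roundRank
  split_ifs with h <;> simp [h]

theorem RankCompatible.inherit [Finite Q] {f : Q → Option ℕ} (h : RankCompatible S f)
    (hT : A.IsSubsetSuccessor σ S T) : RankCompatible T (A.inheritRank σ f) := by
  have hpar : ∀ q', q' ∈ T.carrier → ∃ q ∈ S.carrier, ∃ a, f q = some a ∧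
      q' ∈ A.prunedStep S q σ ∧ A.inheritRank σ f q' = some (A.roundRank q' a) := fun q' hq' => by
    rw [hT.1] at hq'
    obtain ⟨q, hq, hqq'⟩ := exists_mem_prunedStep hq'
    obtain ⟨a, ha⟩ := (h.mem_iff q).1 hq
    exact ⟨q, hq, a, ha, hqq', h.inheritRank_eq hqq' ha⟩
  have hmem : ∀ q', q' ∈ T.carrier ↔ ∃ r, A.inheritRank σ f q' = some r := fun q' => by
    refine ⟨fun hq' => ?_, fun ⟨r, hr⟩ => ?_⟩
    · obtain ⟨q, -, a, -, -, h⟩ := hpar q' hq'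
      exact ⟨_, h⟩
    · by_contra hq'
      have : A.inheritRank σ f q' = none := inheritRank_eq_none_iff.2 fun q hstep => by
        cases hf : f q with
        | none => rfl
        | some a =>
          rw [hT.1] at hq'
          exact absurd (mem_stepSet.2 ⟨q, (h.mem_iff q).2 ⟨a, hf⟩, hstep⟩) hq'
      simp [this] at hr
  refine ⟨hmem, ?_, ?_⟩
  · intro q' r' a' b' hle ha' hb'
    obtain ⟨q, hq, a, ha, hqq', hga⟩ := hpar q' ((hmem q').2 ⟨a', ha'⟩)
    obtain ⟨r, hr, b, hb, hrr', hgb⟩ := hpar r' ((hmem r').2 ⟨b', hb'⟩)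
    rw [hga, Option.some.injEq] at ha'
    rw [hgb, Option.some.injEq] at hb'
    subst ha' hb'
    rcases (hT.le_iff hq hr hqq' hrr').1 hle with hlt | ⟨he, hF⟩
    · have hab : b ≤ a := h.antitone q r a b hlt.1 ha hb
      rcases hab.eq_or_lt with rfl | hab
      -- Strictly ordered parents can share only an even rank, which rounding leaves unchanged.
      · have hev : Even b := by
          by_contra ho
          exact hlt.2 (h.le_of_odd r q b hb ha (Nat.not_even_iff_odd.1 ho))
        rw [Nat.even_iff] at hev
        unfold roundRank
        split_ifs <;> omega
      · by_cases ho : a % 2 = 1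
        · unfold roundRank
          split_ifs <;> omega
        · unfold roundRank
          split_ifs <;> omega
    -- Equivalent parents have equal rank, and if q' is rounded down then so is r'.
    · have hab : a = b := le_antisymm (h.antitone r q b a he.2 hb ha)
        (h.antitone q r a b he.1 ha hb)
      subst hab
      unfold roundRank
      split_ifs with h1 h2
      · exact le_rfl
      · omega
      · exact absurd (hF ‹_›) h1
      · exact le_rfl
  · intro q' r' c ha' hb' ho
    obtain ⟨q, hq, a, ha, hqq', hga⟩ := hpar q' ((hmem q').2 ⟨c, ha'⟩)
    obtain ⟨r, hr, b, hb, hrr', hgb⟩ := hpar r' ((hmem r').2 ⟨c, hb'⟩)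
    rw [hga, Option.some.injEq] at ha'
    rw [hgb, Option.some.injEq] at hb'
    have hqF : q' ∉ A.acc := fun hF =>
      Nat.not_even_iff_odd.2 ho (ha' ▸ even_roundRank.2 (Or.inl hF))
    have hrF : r' ∉ A.acc := fun hF =>
      Nat.not_even_iff_odd.2 ho (hb' ▸ even_roundRank.2 (Or.inl hF))
    rw [roundRank, if_neg hqF] at ha'
    rw [roundRank, if_neg hrF] at hb'
    subst ha' hb'
    refine (hT.le_iff hq hr hqq' hrr').2 (Or.inr ⟨⟨?_, ?_⟩, fun hF => absurd hF hqF⟩)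
    · exact h.le_of_odd q r _ ha hb ho
    · exact h.le_of_odd r q _ hb ha ho

theorem RankCompatible.rankSuccessor [Finite Q] {f : Q → Option ℕ} (h : RankCompatible S f)
    (hT : A.IsSubsetSuccessor σ S T) : RankCompatible T (A.rankSuccessor σ f) :=
  (h.inherit hT).tighten

/-- Along a pruned transition the rank is not increased, and it becomes even iff it was even or the
target is accepting. -/
theorem RankCompatible.exists_rank_of_prunedStep {f : Q → Option ℕ} (h : RankCompatible S f)
    {q q' : Q} {a : ℕ} (hq' : q' ∈ A.prunedStep S q σ) (ha : f q = some a) :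
    ∃ b ≤ a, A.rankSuccessor σ f q' = some b ∧ (Even b ↔ q' ∈ A.acc ∨ Even a) := by
  refine ⟨_, ?_, tighten_eq_some.2 ⟨_, h.inheritRank_eq hq' ha, rfl⟩, ?_⟩
  · exact (tightenRank_le _ _).trans (roundRank_le A q' a)
  · rw [even_tightenRank, even_roundRank]

/-- The inherited rank is a minimum, and rounding and tightening only lower it. No preorder is
involved, so this also covers the edges missing from G'. -/
theorem exists_rank_le_of_step {f : Q → Option ℕ} {q q' : Q} {a : ℕ} (hq' : q' ∈ A.step q σ)
    (ha : f q = some a) : ∃ b ≤ a, A.rankSuccessor σ f q' = some b := by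
  have hmem : a ∈ A.predRanks σ f q' := ⟨q, hq', ha⟩
  have hl : IsLeast (A.predRanks σ f q') (sInf (A.predRanks σ f q')) :=
    ⟨Nat.sInf_mem ⟨a, hmem⟩, fun b hb => Nat.sInf_le hb⟩
  exact ⟨_, (tightenRank_le _ _).trans ((roundRank_le A q' _).trans (hl.2 hmem)),
    tighten_eq_some.2 ⟨_, inheritRank_eq_of_isLeast hl, rfl⟩⟩

/-! ### Acceptance in the second stage -/

variable [Finite Q] {w : ℕ → α} {k : ℕ} {f : ℕ → A.TightRanking} {O : ℕ → Set Q}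

namespace IsRankRun

theorem rank_succ_val (h : A.IsRankRun w k f O) {i : ℕ} (hi : k < i) :
    (f (i + 1)).1 = A.rankSuccessor (w i) (f i).1 := by rw [h.rank_succ i hi]; rfl

theorem rankCompatible (h : A.IsRankRun w k f O) {i : ℕ} (hi : k < i) :
    RankCompatible (A.subsetSeq w i) (f i).1 := by
  induction i, hi using Nat.le_induction with
  | base =>
    rw [h.rank_start]
    exact rankCompatible_toRank fun q r => acc_iff_of_equiv_subsetSeq
  | succ i hi ih =>
    rw [h.rank_succ_val hi]
    exact ih.rankSuccessor (isSubsetSuccessor_subsetSeq A w i)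

theorem obligation_subset (h : A.IsRankRun w k f O) {i : ℕ} (hi : k < i) :
    O i ⊆ evenStates (f i).1 := by
  induction i, hi using Nat.le_induction with
  | base =>
    rw [Nat.succ_eq_add_one, h.obligation_start]
    exact Set.empty_subset _
  | succ i hi ih =>
    rw [h.obligation_succ i hi, h.rank_succ_val hi]
    exact nextObligation_subset ih

theorem mem_obligation_succ_of_eq_empty (h : A.IsRankRun w k f O) {i : ℕ} (hi : k < i)
    (hO : O i = ∅) {q : Q} (hq : q ∈ evenStates (f (i + 1)).1) : q ∈ O (i + 1) := by
  rw [h.obligation_succ i hi, nextObligation, if_pos hO]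
  exact hq

theorem mem_obligation_succ_of_mem (h : A.IsRankRun w k f O) {i : ℕ} (hi : k < i) {p q : Q}
    (hp : p ∈ O i) (hstep : q ∈ A.step p (w i)) (hq : q ∈ evenStates (f (i + 1)).1) :
    q ∈ O (i + 1) := by
  rw [h.obligation_succ i hi, nextObligation, if_neg (Set.nonempty_iff_ne_empty.1 ⟨p, hp⟩)]
  refine ⟨mem_stepSet.2 ⟨p, hp, hstep⟩, ?_⟩
  rintro ⟨r, hr, hodd⟩
  obtain ⟨r', hr', heven⟩ := hq
  rw [hr, Option.some.injEq] at hr'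
  exact Nat.not_even_iff_odd.2 hodd (hr' ▸ heven)

theorem exists_pred_of_mem_obligation (h : A.IsRankRun w k f O) {i : ℕ} (hi : k < i)
    (hO : O i ≠ ∅) {q : Q} (hq : q ∈ O (i + 1)) : ∃ p ∈ O i, q ∈ A.step p (w i) := by
  rw [h.obligation_succ i hi, nextObligation, if_neg hO] at hq
  exact mem_stepSet.1 hq.1

/-- If the obligation set is infinitely often empty, the level is `F`-finite. -/
theorem isFFiniteLevel (h : A.IsRankRun w k f O) (hO : ∃ᶠ i in atTop, O i = ∅) :
    A.IsFFiniteLevel w k := by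
  rintro ⟨q, i⟩ hq hF hi
  simp only at hF hi
  obtain ⟨i₀, hi₀, hO₀⟩ := frequently_atTop.1 hO i
  obtain ⟨i₁, hi₁, hO₁⟩ := frequently_atTop.1 hO (i₀ + 1)
  -- O is reset after i₀, so it catches every descendant beyond i₀, all of even rank. As O is empty
  -- at i₁ > i₀, no descendant lies beyond i₁.
  have key : ∀ v, Relation.ReflTransGen (A.prunedEdge w) (q, i) v →
      k < v.2 ∧ v.1 ∈ evenStates (f v.2).1 ∧ (i₀ < v.2 → v.1 ∈ O v.2) ∧ v.2 ≤ i₁ := by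
    intro v hv
    induction hv with
    | refl =>
      obtain ⟨r, hr⟩ := ((h.rankCompatible hi).mem_iff q).1 (mem_carrier_subsetSeq.2 hq)
      exact ⟨hi, ⟨r, hr, ((f i).2.1 q r hr).2 hF⟩, fun h => absurd h (by simp only; omega),
        by simp only; omega⟩
    | @tail v v' _ hedge ih =>
      obtain ⟨p, j⟩ := v
      obtain ⟨p', j'⟩ := v'
      obtain ⟨rfl, hp, hstep⟩ := prunedEdge_iff.1 hedge
      obtain ⟨hj, ⟨a, ha, hev⟩, hO', hle⟩ := ih
      simp only at hj ha hO' hle ⊢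
      obtain ⟨b, -, hb, hbe⟩ := (h.rankCompatible hj).exists_rank_of_prunedStep hstep ha
      have hmem : p' ∈ evenStates (f (j + 1)).1 :=
        ⟨b, by rw [h.rank_succ_val hj, hb], hbe.2 (Or.inr hev)⟩
      refine ⟨by omega, hmem, fun hlt => ?_, ?_⟩
      · rcases Nat.lt_succ_iff_lt_or_eq.1 hlt with hlt | rfl
        · exact h.mem_obligation_succ_of_mem hj (hO' hlt) hstep.1 hmem
        · exact h.mem_obligation_succ_of_eq_empty hj hO₀ hmem
      · rcases hle.eq_or_lt with rfl | hlt
        · have := hO' (by omega)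
          rw [hO₁] at this
          exact absurd this (Set.notMem_empty _)
        · omega
  exact ((Set.toFinite (Set.univ : Set Q)).prod (Set.finite_Iic i₁)).subset fun v hv =>
    ⟨Set.mem_univ _, (key v hv).2.2.2⟩

/-- If the obligation set is infinitely often empty, the word is rejected. -/
theorem notMem_language (h : A.IsRankRun w k f O) (hO : ∃ᶠ i in atTop, O i = ∅) :
    w ∉ A.language := by
  classical
  rintro ⟨p, ⟨h0, hstep⟩, hacc⟩
  have hmem : ∀ i, p i ∈ (A.subsetSeq w i).carrier := fun i =>
    mem_carrier_subsetSeq.2 ⟨p, ⟨h0, fun j _ => hstep j⟩, rfl⟩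
  -- Take the least rank that the run attains after k; ranks cannot increase along the run, so they
  -- are constant from then on.
  have hex : ∃ r i, k < i ∧ (f i).1 (p i) = some r := by
    obtain ⟨r, hr⟩ := ((h.rankCompatible k.lt_succ_self).mem_iff _).1 (hmem (k + 1))
    exact ⟨r, _, k.lt_succ_self, hr⟩
  obtain ⟨i, hi, hr⟩ := Nat.find_spec hex
  set m := Nat.find hex
  have hconst : ∀ j, i ≤ j → (f j).1 (p j) = some m := fun j hj => by
    induction j, hj using Nat.le_induction with
    | base => exact hr
    | succ j hj ih =>
      obtain ⟨b, hb, hfb⟩ := exists_rank_le_of_step (hstep j) ih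
      rw [← h.rank_succ_val (by omega)] at hfb
      have : m ≤ b := Nat.find_min' hex ⟨j + 1, by omega, hfb⟩
      rw [hfb, le_antisymm hb this]
  have heven : Even m := by
    obtain ⟨j, hj, hF⟩ := frequently_atTop.1 hacc i
    exact ((f j).2.1 _ _ (hconst j hj)).2 hF
  obtain ⟨i₀, hi₀, hO₀⟩ := frequently_atTop.1 hO i
  have hin : ∀ j, i₀ + 1 ≤ j → p j ∈ O j := fun j hj => by
    induction j, hj using Nat.le_induction with
    | base =>
      exact h.mem_obligation_succ_of_eq_empty (by omega) hO₀ ⟨m, hconst _ (by omega), heven⟩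
    | succ j hj ih =>
      exact h.mem_obligation_succ_of_mem (by omega) ih (hstep j) ⟨m, hconst _ (by omega), heven⟩
  obtain ⟨i₁, hi₁, hO₁⟩ := frequently_atTop.1 hO (i₀ + 1)
  have := hin i₁ hi₁
  rw [hO₁] at this
  exact this

/-- Every node of even rank descends from an accepting node in the pruned run dag. -/
theorem exists_acc_ancestor (h : A.IsRankRun w k f O) {i : ℕ} (hi : k < i) {q : Q}
    (hq : q ∈ evenStates (f i).1) : ∃ u ∈ A.dagNodes w, u.1 ∈ A.acc ∧ k < u.2 ∧
      Relation.ReflTransGen (A.prunedEdge w) u (q, i) := by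
  have hacc : ∀ i, k < i → ∀ q ∈ evenStates (f i).1, q ∈ A.acc → ∃ u ∈ A.dagNodes w,
      u.1 ∈ A.acc ∧ k < u.2 ∧ Relation.ReflTransGen (A.prunedEdge w) u (q, i) := by
    rintro i hi q ⟨r, hr, -⟩ hF
    exact ⟨(q, i), mem_carrier_subsetSeq.1 (((h.rankCompatible hi).mem_iff q).2 ⟨r, hr⟩), hF, hi,
      .refl⟩
  induction i, hi using Nat.le_induction generalizing q with
  | base =>
    -- At level k + 1 the ranking is read off the preorder, where even rank means membership in F.
    refine hacc _ k.lt_succ_self q hq ?_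
    obtain ⟨r, hr, hev⟩ := hq
    by_contra hF
    rw [Nat.succ_eq_add_one, h.rank_start] at hr
    change A.toRank _ q = some r at hr
    rw [toRank_of_notMem_acc (mem_carrier_of_toRank hr) hF, Option.some.injEq] at hr
    rw [Nat.even_iff] at hev
    omega
  | succ i hi ih =>
    by_cases hF : q ∈ A.acc
    · exact hacc (i + 1) (by omega) q hq hF
    · obtain ⟨r, hr, hev⟩ := hq
      have hc : q ∈ (A.subsetSeq w (i + 1)).carrier :=
        ((h.rankCompatible (by omega)).mem_iff q).2 ⟨r, hr⟩
      obtain ⟨p, hp, hpq⟩ := exists_mem_prunedStep hc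
      obtain ⟨a, ha⟩ := ((h.rankCompatible hi).mem_iff p).1 hp
      obtain ⟨b, -, hb, hbe⟩ := (h.rankCompatible hi).exists_rank_of_prunedStep hpq ha
      rw [← h.rank_succ_val hi, hr, Option.some.injEq] at hb
      subst hb
      obtain ⟨u, hu, huF, hku, hpath⟩ := ih ⟨a, ha, (hbe.1 hev).resolve_left hF⟩
      exact ⟨u, hu, huF, hku, hpath.tail (prunedEdge_iff.2 ⟨rfl, hp, hpq⟩)⟩

/-- If the level is `F`-finite, the obligation set is infinitely often empty. -/
theorem frequently_obligation_eq_empty (h : A.IsRankRun w k f O) (hk : A.IsFFiniteLevel w k) :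
    ∃ᶠ i in atTop, O i = ∅ := by
  classical
  rw [frequently_atTop]
  by_contra! hne
  obtain ⟨j₀, hne⟩ := hne
  have hne : ∀ i, j₀ ≤ i → (O i).Nonempty := fun i hi => hne i hi
  -- m is the least eventual bound on the ranks in O; minimality forces it to be attained in O at
  -- every level from j on.
  have hex : ∃ m j, j₀ ≤ j ∧ k < j ∧ ∀ z ∈ O j, ∀ r, (f j).1 z = some r → r ≤ m :=
    ⟨A.rankBound, j₀ + k + 1, by omega, by omega, fun z _ r hr => ((f _).2.1 z r hr).1⟩
  obtain ⟨j, hj₀, hkj, hj⟩ := Nat.find_spec hex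
  set m := Nat.find hex
  have hle : ∀ i, j ≤ i → ∀ z ∈ O i, ∀ r, (f i).1 z = some r → r ≤ m := fun i hi => by
    induction i, hi using Nat.le_induction with
    | base => exact hj
    | succ i hi ih =>
      intro z hz r hr
      obtain ⟨p, hp, hstep⟩ := h.exists_pred_of_mem_obligation (by omega)
        (hne i (by omega)).ne_empty hz
      obtain ⟨a, ha, -⟩ := h.obligation_subset (by omega : k < i) hp
      obtain ⟨b, hb, hfb⟩ := exists_rank_le_of_step hstep ha
      rw [← h.rank_succ_val (by omega), hr, Option.some.injEq] at hfb
      exact hfb ▸ hb.trans (ih p hp a ha)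
  have hattained : ∀ i, j ≤ i → ∃ z ∈ O i, (f i).1 z = some m := fun i hi => by
    by_contra! hno
    have hlt : ∀ z ∈ O i, ∀ r, (f i).1 z = some r → r < m := fun z hz r hr =>
      lt_of_le_of_ne (hle i hi z hz r hr) fun hrm => hno z hz (hrm ▸ hr)
    obtain ⟨z, hz⟩ := hne i (by omega)
    obtain ⟨r, hr, -⟩ := h.obligation_subset (by omega : k < i) hz
    have := hlt z hz r hr
    exact Nat.find_min hex (m := m - 1) (by omega)
      ⟨i, by omega, by omega, fun z hz r hr => by have := hlt z hz r hr; omega⟩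
  have heven : Even m := by
    obtain ⟨z, hz, hm⟩ := hattained j le_rfl
    obtain ⟨r, hr, hev⟩ := h.obligation_subset hkj hz
    rw [hm, Option.some.injEq] at hr
    exact hr ▸ hev
  -- the nodes of rank `m` above an obligation of rank `m`
  let P : ℕ → Q → Prop := fun i x => (f i).1 x = some m ∧
    ∃ z ∈ O i, (f i).1 z = some m ∧ (A.subsetSeq w i).le z x
  -- Let p be a pruned parent of x and y an obligated predecessor of z. Then y lies below p, so p
  -- has rank at most that of y, which is at most m. Both ranks are at least m because ranks do not
  -- increase along edges.
  have hpar : ∀ i, j ≤ i → ∀ x, P (i + 1) x → ∃ p, P i p ∧ A.prunedEdge w (p, i) (x, i + 1) := by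
    rintro i hi x ⟨hx, z, hz, hzm, hzx⟩
    have hki : k < i := by omega
    have hc := h.rankCompatible hki
    obtain ⟨hz', hx'⟩ := (A.subsetSeq w (i + 1)).mem_of_le _ _ hzx
    obtain ⟨p, hp, hpx⟩ := exists_mem_prunedStep hx'
    obtain ⟨q, hq, hqz⟩ := exists_mem_prunedStep hz'
    obtain ⟨y, hy, hyz⟩ := h.exists_pred_of_mem_obligation hki (hne i (by omega)).ne_empty hz
    obtain ⟨a, ha⟩ := (hc.mem_iff p).1 hp
    obtain ⟨b, hb, -⟩ := h.obligation_subset hki hy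
    have hyS := (hc.mem_iff y).2 ⟨b, hb⟩
    have hyp : (A.subsetSeq w i).le y p := by
      refine (A.subsetSeq w i).trans _ _ _ (hqz.2 y hyS hyz) ?_
      rcases ((isSubsetSuccessor_subsetSeq A w i).le_iff hq hp hqz hpx).1 hzx with h | h
      · exact h.1
      · exact h.1.1
    have hbm : b = m := by
      refine le_antisymm (hle i hi y hy b hb) ?_
      obtain ⟨c, hcb, hc⟩ := exists_rank_le_of_step hyz hb
      rw [← h.rank_succ_val hki, hzm, Option.some.injEq] at hc
      omega
    have ham : a = m := by
      refine le_antisymm (hbm ▸ hc.antitone y p b a hyp hb ha) ?_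
      obtain ⟨c, hca, hc, -⟩ := hc.exists_rank_of_prunedStep hpx ha
      rw [← h.rank_succ_val hki, hx, Option.some.injEq] at hc
      omega
    subst hbm
    exact ⟨p, ⟨ham ▸ ha, y, hy, hb, hyp⟩, prunedEdge_iff.2 ⟨rfl, hp, hpx⟩⟩
  have hanc : ∀ i, j ≤ i → ∀ x, P i x → ∃ y, P j y ∧
      Relation.ReflTransGen (A.prunedEdge w) (y, j) (x, i) := fun i hi => by
    induction i, hi using Nat.le_induction with
    | base => exact fun x hx => ⟨x, hx, .refl⟩
    | succ i hi ih =>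
      intro x hx
      obtain ⟨p, hp, hedge⟩ := hpar i hi x hx
      obtain ⟨y, hy, hpath⟩ := ih p hp
      exact ⟨y, hy, hpath.tail hedge⟩
  -- Nodes of rank m at level j have even rank, hence descend in G' from F-nodes after k and have
  -- finitely many descendants. Yet their descendants reach every later level.
  have hfin : (⋃ y ∈ {y | P j y},
      {v | Relation.ReflTransGen (A.prunedEdge w) (y, j) v}).Finite := by
    refine Set.Finite.biUnion (Set.toFinite _) fun y hy => ?_
    obtain ⟨u, hu, hF, hku, hpath⟩ := h.exists_acc_ancestor hkj ⟨m, hy.1, heven⟩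
    exact (hk u hu hF hku).subset fun v hv => hpath.trans hv
  obtain ⟨L, hL⟩ := (hfin.image Prod.snd).bddAbove
  obtain ⟨z, hz, hzm⟩ := hattained (j + L + 1) (by omega)
  have hzS := ((h.rankCompatible (by omega : k < j + L + 1)).mem_iff z).2 ⟨m, hzm⟩
  obtain ⟨y, hy, hpath⟩ := hanc (j + L + 1) (by omega) z
    ⟨hzm, z, hz, hzm, PreorderedSubset.refl hzS⟩
  have := hL ⟨_, Set.mem_biUnion hy hpath, rfl⟩
  simp only at this
  omega

end IsRankRun

theorem exists_acceptingRun_iff_isFFiniteLevel :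
    (∃ p, A.retro.IsAcceptingRun w p ∧ ∀ i, (p i).isLeft = true ↔ i ≤ k) ↔
      A.IsFFiniteLevel w k := by
  rw [exists_acceptingRun_iff]
  constructor
  · rintro ⟨f, O, h, hO⟩
    exact h.isFFiniteLevel hO
  · intro hk
    obtain ⟨f, O, h⟩ := exists_isRankRun A w k
    exact ⟨f, O, h, h.frequently_obligation_eq_empty hk⟩

end NBW

namespace NBW

variable {α : Type u} {Q : Type v} {A : NBW α Q} {w : ℕ → α}

/-- A path of the run dag that starts in a node is the tail of a run. -/
theorem mem_language_of_path {k : ℕ} {π : ℕ → Q} (h0 : (π 0, k) ∈ A.dagNodes w)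
    (hstep : ∀ i, π (i + 1) ∈ A.step (π i) (w (k + i))) (hacc : ∃ᶠ i in atTop, π i ∈ A.acc) :
    w ∈ A.language := by
  obtain ⟨b, ⟨hb0, hb⟩, hbk⟩ := mem_dagNodes.1 h0
  refine ⟨fun i => if i ≤ k then b i else π (i - k), ⟨by simpa using hb0, fun i => ?_⟩, ?_⟩
  · rcases lt_trichotomy i k with hi | rfl | hi
    · have h1 : i + 1 ≤ k := hi
      simpa [h1, hi.le] using hb i hi
    · simpa [hbk] using hstep 0
    · obtain ⟨j, rfl⟩ : ∃ j, i = k + j := ⟨i - k, by omega⟩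
      have h1 : ¬ k + j + 1 ≤ k := by omega
      have h2 : ¬ k + j ≤ k := by omega
      have h3 : k + j + 1 - k = j + 1 := by omega
      have h4 : k + j - k = j := by omega
      simp only [h1, h2, h3, h4, if_false]
      exact hstep j
  · rw [frequently_atTop] at hacc ⊢
    intro N
    obtain ⟨j, hj, hF⟩ := hacc (N + 1)
    refine ⟨k + j, by omega, ?_⟩
    have h2 : ¬ k + j ≤ k := by omega
    have h4 : k + j - k = j := by omega
    simpa only [h2, h4, if_false] using hF

/-! ### The infinite part of the pruned run dag -/

variable [Finite Q]

/-- The nodes with infinitely many descendants in the pruned run dag. -/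
def infiniteNodes (A : NBW α Q) (w : ℕ → α) : Set (Q × ℕ) :=
  {u | u ∈ A.dagNodes w ∧ ¬ A.FiniteInPruned w u}

/-- The step of König's lemma: finitely many children with finitely many descendants each would make
the node finite. -/
theorem exists_infinite_child {q : Q} {i : ℕ} (h : (q, i) ∈ A.infiniteNodes w) :
    ∃ r, A.prunedEdge w (q, i) (r, i + 1) ∧ (r, i + 1) ∈ A.infiniteNodes w := by
  by_contra! hno
  refine h.2 ?_
  have hsub : {v | Relation.ReflTransGen (A.prunedEdge w) (q, i) v} ⊆ insert (q, i)
      (⋃ r ∈ {r | A.prunedEdge w (q, i) (r, i + 1)},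
        {v | Relation.ReflTransGen (A.prunedEdge w) (r, i + 1) v}) := by
    intro v hv
    rcases Relation.ReflTransGen.cases_head hv with rfl | ⟨⟨r, j⟩, hedge, hpath⟩
    · exact Or.inl rfl
    · obtain ⟨rfl, -, -⟩ := prunedEdge_iff.1 hedge
      exact Or.inr (Set.mem_biUnion hedge hpath)
  refine ((Set.Finite.biUnion (Set.toFinite _) fun r hr => ?_).insert _).subset hsub
  by_contra hinf
  exact hno r hr ⟨mem_dagNodes_succ.2 ⟨q, hr.1.1, hr.1.2.2⟩, hinf⟩

theorem exists_infinite_path {q : Q} {k : ℕ} (h : (q, k) ∈ A.infiniteNodes w) :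
    ∃ π : ℕ → Q, π 0 = q ∧ (∀ i, (π i, k + i) ∈ A.infiniteNodes w) ∧
      ∀ i, A.prunedEdge w (π i, k + i) (π (i + 1), k + (i + 1)) := by
  have hnext : ∀ (i : ℕ) (x : {x // (x, k + i) ∈ A.infiniteNodes w}),
      ∃ y : {y // (y, k + (i + 1)) ∈ A.infiniteNodes w},
        A.prunedEdge w (x.1, k + i) (y.1, k + (i + 1)) := fun i x => by
    obtain ⟨r, hr, hinf⟩ := exists_infinite_child x.2
    exact ⟨⟨r, hinf⟩, hr⟩
  choose next hedge using hnext
  let s : ∀ i, {x // (x, k + i) ∈ A.infiniteNodes w} := fun i =>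
    Nat.rec (motive := fun i => {x // (x, k + i) ∈ A.infiniteNodes w}) ⟨q, h⟩ next i
  exact ⟨fun i => (s i).1, rfl, fun i => (s i).2, fun i => hedge i (s i)⟩

/-- A strict order between pruned parents passes to their children. -/
theorem not_equiv_of_prunedEdge {p q p' q' : Q} {i : ℕ} (hp : A.prunedEdge w (p, i) (p', i + 1))
    (hq : A.prunedEdge w (q, i) (q', i + 1)) (hne : ¬ (A.subsetSeq w i).equiv p q) :
    ¬ (A.subsetSeq w (i + 1)).equiv p' q' := by
  obtain ⟨-, hpS, hpp⟩ := prunedEdge_iff.1 hp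
  obtain ⟨-, hqS, hqq⟩ := prunedEdge_iff.1 hq
  have hs := isSubsetSuccessor_subsetSeq A w i
  rcases PreorderedSubset.lt_or_equiv_or_lt hpS hqS with h | h | h
  · exact fun h' => ((hs.2 p hpS q hqS p' hpp q' hqq).1 h).2 h'.2
  · exact absurd h hne
  · exact fun h' => ((hs.2 q hqS p hpS q' hqq p' hpp).1 h).2 h'.1

/-- A rejected word has an `F`-finite level. -/
theorem exists_isFFiniteLevel (hw : w ∉ A.language) : ∃ k, A.IsFFiniteLevel w k := by
  classical
  -- N pairwise inequivalent infinite nodes on a common level. N is bounded by |Q|, and the empty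
  -- set shows that a greatest N exists.
  let P : ℕ → Prop := fun N => ∃ (k : ℕ) (R : Set Q), R.ncard = N ∧
    (∀ q ∈ R, (q, k) ∈ A.infiniteNodes w) ∧
    ∀ p ∈ R, ∀ q ∈ R, p ≠ q → ¬ (A.subsetSeq w k).equiv p q
  have hbound : ∀ N, P N → N ≤ Nat.card Q := by
    rintro N ⟨k, R, rfl, -⟩
    exact Set.ncard_le_card R
  have hP0 : P 0 := ⟨0, ∅, by simp, by simp, by simp⟩
  have hspec : P (Nat.findGreatest P (Nat.card Q)) := Nat.findGreatest_spec (Nat.zero_le _) hP0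
  have hmax : ∀ N, P N → N ≤ Nat.findGreatest P (Nat.card Q) := fun N hN =>
    Nat.le_findGreatest (hbound N hN) hN
  obtain ⟨k, R, hcard, hinf, hineq⟩ := hspec
  have hpath : ∀ q : R, ∃ π : ℕ → Q, π 0 = q.1 ∧ (∀ i, (π i, k + i) ∈ A.infiniteNodes w) ∧
      ∀ i, A.prunedEdge w (π i, k + i) (π (i + 1), k + (i + 1)) := fun q =>
    exists_infinite_path (hinf q.1 q.2)
  choose π h0 hπ hedge using hpath
  have hsep : ∀ i (p q : R), p ≠ q → ¬ (A.subsetSeq w (k + i)).equiv (π p i) (π q i) :=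
    fun i p q hpq => by
    induction i with
    | zero =>
      rw [h0, h0]
      exact hineq p.1 p.2 q.1 q.2 fun h => hpq (Subtype.ext h)
    | succ i ih => exact not_equiv_of_prunedEdge (hedge p i) (hedge q i) ih
  -- An infinite node equivalent to none of the paths' nodes could be added to them, against
  -- maximality.
  have hcov : ∀ i v, (v, k + i) ∈ A.infiniteNodes w →
      ∃ q : R, (A.subsetSeq w (k + i)).equiv v (π q i) := by
    intro i v hv
    by_contra! hno
    have hmemS : ∀ x, (x, k + i) ∈ A.infiniteNodes w → x ∈ (A.subsetSeq w (k + i)).carrier :=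
      fun x hx => mem_carrier_subsetSeq.2 hx.1
    have hrefl : ∀ x, (x, k + i) ∈ A.infiniteNodes w → (A.subsetSeq w (k + i)).equiv x x :=
      fun x hx => ⟨PreorderedSubset.refl (hmemS x hx), PreorderedSubset.refl (hmemS x hx)⟩
    have hinj : Function.Injective fun q : R => π q i := fun p q hpq => by
      by_contra hne
      refine hsep i p q hne ?_
      rw [show π p i = π q i from hpq]
      exact hrefl _ (hπ q i)
    have hv' : v ∉ Set.range fun q : R => π q i := by
      rintro ⟨q, rfl⟩
      exact hno q (hrefl _ hv)
    have hc : (Set.range fun q : R => π q i).ncard = R.ncard := by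
      rw [← Set.image_univ, Set.ncard_image_of_injective _ hinj, Set.ncard_univ,
        Nat.card_coe_set_eq]
    have := hmax (R.ncard + 1) ⟨k + i, insert v (Set.range fun q : R => π q i), by
      rw [Set.ncard_insert_of_notMem hv' (Set.toFinite _), hc], by
      rintro q (rfl | ⟨q, rfl⟩)
      · exact hv
      · exact hπ q i, by
      rintro p (rfl | ⟨p, rfl⟩) q (rfl | ⟨q, rfl⟩) hpq
      · exact absurd rfl hpq
      · exact hno q
      · exact fun h => hno p ⟨h.2, h.1⟩
      · exact hsep i p q fun h => hpq (h ▸ rfl)⟩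
    omega
  by_contra! hno
  have hfreq : ∃ᶠ i in atTop, ∃ q : R, π q i ∈ A.acc := by
    rw [frequently_atTop]
    intro N
    have hN := hno (k + N)
    unfold IsFFiniteLevel at hN
    push Not at hN
    obtain ⟨⟨v, j⟩, hv, hF, hj, hninf⟩ := hN
    simp only at hF hj
    obtain ⟨i, rfl⟩ : ∃ i, j = k + i := ⟨j - k, by omega⟩
    obtain ⟨q, hq⟩ := hcov i v ⟨hv, hninf⟩
    exact ⟨i, by omega, q, (acc_iff_of_equiv_subsetSeq hq).1 hF⟩
  -- Pigeonhole over the finitely many paths.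
  have : ∃ q : R, ∃ᶠ i in atTop, π q i ∈ A.acc := by
    by_contra! hno
    rw [← eventually_all] at hno
    exact hfreq (hno.mono fun i hi => by simpa using hi)
  obtain ⟨q, hq⟩ := this
  exact hw (mem_language_of_path (k := k) (π := π q) (hπ q 0).1
    (fun i => (hedge q i).1.2.2) hq)

end NBW

/-! ### The number of states -/

/-- With F empty every rank is 2β + 1, and β reverses the preorder strictly, so the preorder can be
recovered from the ranking. -/
theorem injective_toRank_of_acc_eq_empty {α : Type u} {Q : Type v} [Finite Q] {A : NBW α Q}
    (hA : A.acc = ∅) : Function.Injective A.toRank := by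
  have hF : ∀ q, q ∉ A.acc := fun q => by simp [hA]
  have hmem : ∀ S q, q ∈ S.carrier ↔ ∃ r, A.toRank S q = some r := fun S q =>
    ⟨fun h => ⟨_, NBW.toRank_of_notMem_acc h (hF q)⟩, fun ⟨_, h⟩ => NBW.mem_carrier_of_toRank h⟩
  have hle : ∀ S q r, S.le q r ↔ ∃ a b, A.toRank S q = some a ∧ A.toRank S r = some b ∧ b ≤ a := by
    intro S q r
    constructor
    · intro h
      obtain ⟨hq, hr⟩ := S.mem_of_le _ _ h
      refine ⟨_, _, NBW.toRank_of_notMem_acc hq (hF q), NBW.toRank_of_notMem_acc hr (hF r), ?_⟩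
      have := NBW.classesAbove_antitone (A := A) h
      omega
    · rintro ⟨a, b, ha, hb, hab⟩
      have hq := NBW.mem_carrier_of_toRank ha
      have hr := NBW.mem_carrier_of_toRank hb
      rw [NBW.toRank_of_notMem_acc hq (hF q), Option.some.injEq] at ha
      rw [NBW.toRank_of_notMem_acc hr (hF r), Option.some.injEq] at hb
      by_contra h
      have := NBW.classesAbove_lt (A := A) (PreorderedSubset.lt_of_not_le hq hr h) (hF q)
      omega
  intro S T h
  refine PreorderedSubset.ext (Set.ext fun q => ?_) (funext fun q => funext fun r => propext ?_)
  · rw [hmem, hmem, h]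
  · rw [hle, hle, h]

theorem card_preorderedSubset_le (Q : Type v) [Finite Q] :
    Nat.card (PreorderedSubset Q) ≤ (tightPairs (Set.univ : Set Q)).ncard := by
  -- The count of preordered subsets involves no automaton; one with F empty is chosen to make
  -- `toRank` injective.
  let A : NBW Unit Q := ⟨∅, fun _ _ => ∅, ∅⟩
  rw [← Set.ncard_univ]
  refine Set.ncard_le_ncard_of_injOn (fun S => (A.toRank S, ∅))
    (fun S _ => ⟨fun _ _ _ => Set.mem_univ _, NBW.isTight_toRank A S, Set.empty_subset _⟩) ?_
    (tightPairs_finite _)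
  intro S _ T _ h
  exact injective_toRank_of_acc_eq_empty (A := A) rfl (Prod.ext_iff.1 h).1

theorem ncard_evenObligationStates_le {α : Type u} {Q : Type v} [Finite Q] (A : NBW α Q) :
    A.evenObligationStates.ncard ≤ 2 * (tightPairs (Set.univ : Set Q)).ncard := by
  have hsub : A.evenObligationStates ⊆ Set.range Sum.inl ∪
      Sum.inr '' {s : A.TightRanking × Set Q | s.2 ⊆ NBW.evenStates s.1.1} := by
    rintro (S | ⟨f, O⟩) h
    · exact Or.inl ⟨S, rfl⟩
    · exact Or.inr ⟨(f, O), h f O rfl, rfl⟩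
  refine (Set.ncard_le_ncard hsub (Set.toFinite _)).trans ((Set.ncard_union_le _ _).trans ?_)
  rw [two_mul]
  refine add_le_add ?_ ?_
  · rw [← Set.image_univ, Set.ncard_image_of_injective _ Sum.inl_injective, Set.ncard_univ]
    exact card_preorderedSubset_le Q
  · rw [Set.ncard_image_of_injective _ Sum.inr_injective]
    refine Set.ncard_le_ncard_of_injOn (fun s => (s.1.1, s.2))
      (fun s hs => ⟨fun _ _ _ => Set.mem_univ _, s.1.2.2, hs⟩) ?_ (tightPairs_finite _)
    intro s _ t _ h
    have h := Prod.ext_iff.1 h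
    exact Prod.ext (Subtype.ext h.1) h.2

theorem ncard_evenObligationStates_le_real {α : Type u} {Q : Type v} [Finite Q] (A : NBW α Q)
    {y : ℝ} (hy : 1 < y) (hroot : y ^ 3 = y ^ 2 + 1) (hQ : 1 ≤ Nat.card Q) :
    (A.evenObligationStates.ncard : ℝ) ≤ 2 * y ^ 3 * Real.exp 1 * √(Nat.card Q : ℝ) *
      (1 / (Real.exp 1 * Real.log y) * (Nat.card Q : ℝ)) ^ Nat.card Q := by
  have hx : 0 < Real.log y := Real.log_pos hy
  have h1 : (A.evenObligationStates.ncard : ℝ) ≤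
      2 * ((tightPairs (Set.univ : Set Q)).ncard : ℝ) := by
    exact_mod_cast ncard_evenObligationStates_le A
  have h2 := ncard_tightPairs_univ_le (Q := Q) hx (Real.exp_log (by linarith)) hroot
  have h3 := factorial_le_exp_mul_sqrt_mul_pow hQ
  set n := Nat.card Q
  calc (A.evenObligationStates.ncard : ℝ)
      ≤ 2 * (n.factorial / Real.log y ^ n * y ^ 3) := h1.trans (by gcongr)
    _ ≤ 2 * (Real.exp 1 * √n * (n / Real.exp 1) ^ n / Real.log y ^ n * y ^ 3) := by gcongr
    _ = _ := by
      have : 1 / (Real.exp 1 * Real.log y) * (n : ℝ) = n / Real.exp 1 / Real.log y := by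
        field_simp
      rw [this, div_pow _ (Real.log y)]
      ring

theorem mainTheorem1 :
    (∀ (α : Type u) (Q : Type v) [Finite α] [Finite Q] (A : NBW α Q),
      -- `A_L` is a Büchi automaton with finitely many states, for the complementary language
      Finite A.RetroState ∧
      A.retro.language = A.languageᶜ ∧
      -- the first stage: a deterministic update, and a guess whether to change stage
      (∀ (S : PreorderedSubset Q) (σ : α), ∃ (S' : PreorderedSubset Q) (f : A.TightRanking),
        (∀ T, A.IsSubsetSuccessor σ S T ↔ T = S') ∧ f.1 = A.toRank S' ∧
        A.retro.step (.inl S) σ = {.inl S', .inr (f, ∅)}) ∧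
      -- the second stage is deterministic
      (∀ (f : A.TightRanking) (O : Set Q) (σ : α), ∃ f' : A.TightRanking,
        f'.1 = A.rankSuccessor σ f.1 ∧
        A.retro.step (.inr (f, O)) σ = {.inr (f', A.nextObligation σ O f'.1)}) ∧
      -- the guess of the level `k` after which the stage changes is right iff `k` is `F`-finite
      (∀ (w : ℕ → α) (k : ℕ),
        (∃ p, A.retro.IsAcceptingRun w p ∧ ∀ i, (p i).isLeft = true ↔ i ≤ k) ↔
          A.IsFFiniteLevel w k) ∧
      A.retro.DeterministicInTheLimit ∧
      (∀ (s : A.RetroState) (σ : α), (A.retro.step s σ).encard ≤ 2) ∧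
      A.retro.reachable ⊆ A.evenObligationStates) ∧
    -- the number of states
    (∃ y κ C : ℝ, 1 < y ∧ y ^ 3 = y ^ 2 + 1 ∧ κ = 1 / (Real.exp 1 * Real.log y) ∧
      0.962 < κ ∧ κ < 0.963 ∧
      ∀ (α : Type u) (Q : Type v) [Finite α] [Finite Q] (A : NBW α Q), 1 ≤ Nat.card Q →
        (A.evenObligationStates.ncard : ℝ) ≤
          C * √(Nat.card Q : ℝ) * (κ * (Nat.card Q : ℝ)) ^ Nat.card Q) := by
  refine ⟨fun α Q _ _ A => ⟨inferInstance, ?_, fun S σ => ?_, fun f O σ => ?_, fun w k =>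
    NBW.exists_acceptingRun_iff_isFFiniteLevel, NBW.deterministicInTheLimit_retro A,
    NBW.encard_retroStep_le_two, NBW.reachable_retro_subset A⟩, ?_⟩
  · ext w
    rw [NBW.mem_language_retro_iff, Set.mem_compl_iff]
    constructor
    · rintro ⟨k, hk⟩
      obtain ⟨f, O, h, hO⟩ := NBW.exists_acceptingRun_iff.1 hk
      exact h.notMem_language hO
    · intro hw
      obtain ⟨k, hk⟩ := NBW.exists_isFFiniteLevel hw
      exact ⟨k, NBW.exists_acceptingRun_iff_isFFiniteLevel.2 hk⟩
  · exact ⟨A.subsetSucc σ S, A.toTightRanking _, fun _ => NBW.isSubsetSuccessor_iff, rfl,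
      Set.ext fun _ => NBW.mem_retroStep_inl⟩
  · exact ⟨A.tightSucc σ f.1, rfl, Set.ext fun _ => NBW.mem_retroStep_inr⟩
  · obtain ⟨y, h1, h2, hroot⟩ := exists_root_cube_eq_sq_add_one
    obtain ⟨hl, hu⟩ := inv_exp_mul_log_bounds h1 h2
    have hy : 1 < y := by linarith
    -- In C, the 2 accounts for the two stages, y^3 for the numerator e^(3x) at the pole, and e for
    -- Stirling's formula.
    exact ⟨y, _, 2 * y ^ 3 * Real.exp 1, hy, hroot, rfl, hl, hu, fun α Q _ _ A hQ =>
      ncard_evenObligationStates_le_real A hy hroot hQ⟩
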